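/- Let $\mu_+,\mu_-,\nu_+,\gamma_{1+},\gamma_{1-},\gamma_{2+},b>0$, $0<\varepsilon<\pi/2$, $\lambda_0>0$ and $\delta_0>0$. Put $$\Sigma_\varepsilon=\{\lambda\in\mathbb C\setminus\{0\}: |\arg\lambda|\le \pi-\varepsilon\},\qquad \Sigma_{\varepsilon,\lambda_0}=\{\lambda\in\Sigma_\varepsilon:|\lambda|\ge\lambda_0\},$$ $$K_\varepsilon=\{\lambda\in\mathbb C: (\Re\lambda+\gamma_{1+}\gamma_{2+}\nu_+^{-1}+\varepsilon)^2+(\Im\lambda)^2\ge(\gamma_{1+}\gamma_{2+}\nu_+^{-1}+\varepsilon)^2\}.$$ For $\lambda,\delta\in\mathbb C$ we write $\lambda\in\Gamma_{\varepsilon,\lambda_0}$ (with associated parameter $\delta$) if one of the following three cases holds: * (C1) $\lambda\in\Sigma_{\varepsilon,\lambda_0}\cap K_\varepsilon$ and $\delta=\gamma_{1+}\gamma_{2+}\lambda^{-1}$; * (C2) $\delta\in\Sigma_\varepsilon$, $\Re\delta<0$, $|\delta|\le\delta_0$, $|\lambda|\ge\lambda_0$ and $\Re\lambda\ge|\Re\delta/\Im\delta|\,|\Im\lambda|$;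 * (C3) $\delta\in\Sigma_\varepsilon$, $\Re\delta\ge0$, $|\delta|\le\delta_0$, $|\lambda|\ge\lambda_0$ and $\Re\lambda\ge\lambda_0|\Im\lambda|$. For $N\ge2$ and $\xi'\in\mathbb R^{N-1}\setminus\{0\}$ let $A=|\xi'|$ and, with principal square roots, $$A_+=\sqrt{\tfrac{\gamma_{1+}\lambda}{\mu_++\nu_++\delta}+A^2},\qquad B_\pm=\sqrt{\tfrac{\gamma_{1\pm}\lambda}{\mu_\pm}+A^2},$$ $$M=\frac{e^{-B_-b}-e^{-Ab}}{B_--A},\qquad D=A_+B_+-A^2 .$$ Define $$\begin{aligned} L_{11}^+&=-\mu_+\frac{A_+(B_+^2-A^2)}{D}, & L_{12}^+&=-\mu_+\frac{A^2(2A_+B_+-A^2-B_+^2)}{D},\\ L_{21}^+&=-A\Big(2\mu_+\frac{A_+(B_+-A_+)}{D}-(\nu_+-\mu_++\delta)\frac{A_+^2-A^2}{D}\Big), & L_{22}^+&=-(\mu_++\nu_++\delta)\frac{AB_+(A_+^2-A^2)}{D},\\ L_{11}^{0-}&=-\mu_-(A+B_-), & L_{12}^{0-}&=-\mu_-(B_--A)A,\\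 L_{21}^{0-}&=-\mu_-(B_--A), & L_{22}^{0-}&=-\mu_-(A+B_-)B_-,\\ L_{11}^{b-}&=\mu_-\big((A+B_-)e^{-B_-b}+2A^2M\big), & L_{12}^{b-}&=-\mu_-\big(2A^2B_-M+(B_--A)Ae^{-B_-b}\big),\\ L_{21}^{b-}&=2\mu_-AB_-M-\mu_-(B_--A)e^{-Ab}, & L_{22}^{b-}&=-2\mu_-A^2B_-M+\mu_-(B_-+A)B_-e^{-Ab}, \end{aligned}$$ and, for $k=1,2$, $$\mathfrak L_k=-(AL_{k1}^++L_{k2}^+)(A+B_-)M^2-L_{k1}^{b-}AM+L_{k2}^{b-}M,$$ $$\begin{aligned} L_{k1}&=L_{k1}^+\big(1-e^{-2B_-b}-2e^{-B_-b}AM\big)+L_{k1}^{0-}-L_{k1}^{b-}e^{-B_-b}+\mathfrak L_k,\\ L_{k2}&=L_{k2}^+\big(1-e^{-2B_-b}+2e^{-B_-b}B_-M\big)+L_{k2}^{0-}-L_{k2}^{b-}e^{-B_-b}+B_-\mathfrak L_k. \end{aligned}$$ Let $\det\mathbf L=L_{11}L_{22}-L_{12}L_{21}$. Then there is a constant $C>0$,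 depending only on $\mu_\pm,\nu_+,\gamma_{1\pm},\gamma_{2+},\varepsilon,\lambda_0,b$ and, in cases (C2) and (C3), on the bound $\delta_0$ for $|\delta|$, such that $$|\det\mathbf L|\ \ge\ C\big(|\lambda|^{1/2}+|\xi'|\big)^3$$ for all $\lambda\in\Gamma_{\varepsilon,\lambda_0}$ with associated parameter $\delta$, all $N\ge 2$ and all $\xi'\in\mathbb R^{N-1}\setminus\{0\}$. -/

import Mathlib

noncomputable section

/-- The constants of the gas-liquid two-phase problem: the viscosities `μ₊`, `μ₋`, `ν₊`, the
coefficients `γ₁₊`, `γ₁₋`, `γ₂₊`, and the depth `b` of the liquid layer `-b < x_N < 0`. -/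
structure PhysParams where
  muP : ℝ
  muM : ℝ
  nuP : ℝ
  gam1P : ℝ
  gam1M : ℝ
  gam2P : ℝ
  b : ℝ

/-- All the constants are positive. -/
structure PhysParams.Positive (P : PhysParams) : Prop where
  muP_pos : 0 < P.muP
  muM_pos : 0 < P.muM
  nuP_pos : 0 < P.nuP
  gam1P_pos : 0 < P.gam1P
  gam1M_pos : 0 < P.gam1M
  gam2P_pos : 0 < P.gam2P
  b_pos : 0 < P.b

/-- The sector `Σ_ε = {λ ∈ ℂ ∖ {0} : |arg λ| ≤ π - ε}`, with `arg` the principal argument. -/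
def sectorSet (ε : ℝ) : Set ℂ :=
  {lam | lam ≠ 0 ∧ |lam.arg| ≤ Real.pi - ε}

/-- `Σ_{ε,λ₀} = {λ ∈ Σ_ε : |λ| ≥ λ₀}`. -/
def truncSectorSet (ε lam0 : ℝ) : Set ℂ :=
  {lam | lam ∈ sectorSet ε ∧ lam0 ≤ ‖lam‖}

namespace PhysParams

/-- `K_ε`: the complement of an open disk centred on the negative real axis whose boundary
passes through the origin. -/
def setK (P : PhysParams) (ε : ℝ) : Set ℂ :=
  {lam | (P.gam1P * P.gam2P * P.nuP⁻¹ + ε) ^ 2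
      ≤ (lam.re + P.gam1P * P.gam2P * P.nuP⁻¹ + ε) ^ 2 + lam.im ^ 2}

/-- Case (C1) for the pair `(λ, δ)`. -/
def CaseC1 (P : PhysParams) (ε lam0 : ℝ) (lam delta : ℂ) : Prop :=
  lam ∈ truncSectorSet ε lam0 ∩ P.setK ε ∧ delta = (P.gam1P : ℂ) * (P.gam2P : ℂ) * lam⁻¹

end PhysParams

/-- Case (C2) for the pair `(λ, δ)`. Here `Im δ ≠ 0` is automatic, for `Re δ < 0` and
`δ ∈ Σ_ε`. -/
def CaseC2 (ε lam0 delta0 : ℝ) (lam delta : ℂ) : Prop :=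
  delta ∈ sectorSet ε ∧ delta.re < 0 ∧ ‖delta‖ ≤ delta0 ∧
    lam0 ≤ ‖lam‖ ∧ |delta.re / delta.im| * |lam.im| ≤ lam.re

/-- Case (C3) for the pair `(λ, δ)`. -/
def CaseC3 (ε lam0 delta0 : ℝ) (lam delta : ℂ) : Prop :=
  delta ∈ sectorSet ε ∧ 0 ≤ delta.re ∧ ‖delta‖ ≤ delta0 ∧
    lam0 ≤ ‖lam‖ ∧ lam0 * |lam.im| ≤ lam.re

/-- `λ ∈ Γ_{ε,λ₀}`, where `δ` is the parameter that belongs to `λ`: one of the three cases of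
the standing assumption on `(λ, δ)` holds. -/
def PhysParams.MemGamma (P : PhysParams) (ε lam0 delta0 : ℝ) (lam delta : ℂ) : Prop :=
  P.CaseC1 ε lam0 lam delta ∨ CaseC2 ε lam0 delta0 lam delta ∨ CaseC3 ε lam0 delta0 lam delta

/-- The principal square root, with values in the closed right half-plane. -/
def csqrt (z : ℂ) : ℂ := z ^ (1 / 2 : ℂ)

namespace PhysParams

/-! In what follows `lam` is `λ`, `delta` is `δ`, and the real number `A` is `|ξ'|`. -/

/-- The characteristic root `A₊`. -/
def rootAP (P : PhysParams) (lam delta : ℂ) (A : ℝ) : ℂ :=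
  csqrt ((P.gam1P : ℂ) * ((P.muP : ℂ) + (P.nuP : ℂ) + delta)⁻¹ * lam + (A : ℂ) ^ 2)

/-- The characteristic root `B₊`. -/
def rootBP (P : PhysParams) (lam : ℂ) (A : ℝ) : ℂ :=
  csqrt ((P.gam1P : ℂ) * (P.muP : ℂ)⁻¹ * lam + (A : ℂ) ^ 2)

/-- The characteristic root `B₋`. -/
def rootBM (P : PhysParams) (lam : ℂ) (A : ℝ) : ℂ :=
  csqrt ((P.gam1M : ℂ) * (P.muM : ℂ)⁻¹ * lam + (A : ℂ) ^ 2)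

/-- The Stokes kernel `M₋(z) = (e^{B₋ z} - e^{A z}) / (B₋ - A)`. -/
def kerM (P : PhysParams) (lam : ℂ) (A z : ℝ) : ℂ :=
  (Complex.exp (P.rootBM lam A * z) - Complex.exp ((A : ℂ) * z)) / (P.rootBM lam A - A)

/-- `e^{-B₋ b}`. -/
def expB (P : PhysParams) (lam : ℂ) (A : ℝ) : ℂ :=
  Complex.exp (-(P.rootBM lam A * P.b))

/-- `e^{-A b}`. -/
def expA (P : PhysParams) (A : ℝ) : ℂ :=
  Complex.exp (-((A : ℂ) * P.b))

/-- The common denominator `A₊ B₊ - A²`. -/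
def den (P : PhysParams) (lam delta : ℂ) (A : ℝ) : ℂ :=
  P.rootAP lam delta A * P.rootBP lam A - (A : ℂ) ^ 2

/-- `L₁₁⁺`. -/
def L11P (P : PhysParams) (lam delta : ℂ) (A : ℝ) : ℂ :=
  -(P.muP : ℂ) * (P.rootAP lam delta A * (P.rootBP lam A ^ 2 - (A : ℂ) ^ 2)
    / P.den lam delta A)

/-- `L₁₁^{0-}`. -/
def L11Z (P : PhysParams) (lam : ℂ) (A : ℝ) : ℂ :=
  -(P.muM : ℂ) * (A + P.rootBM lam A)

/-- `L₁₁^{b-}`. -/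
def L11B (P : PhysParams) (lam : ℂ) (A : ℝ) : ℂ :=
  (P.muM : ℂ) * ((A + P.rootBM lam A) * P.expB lam A
    + 2 * (A : ℂ) ^ 2 * P.kerM lam A (-P.b))

/-- `L₁₂⁺`. -/
def L12P (P : PhysParams) (lam delta : ℂ) (A : ℝ) : ℂ :=
  -(P.muP : ℂ) * ((A : ℂ) ^ 2
    * (2 * P.rootAP lam delta A * P.rootBP lam A - (A : ℂ) ^ 2 - P.rootBP lam A ^ 2)
    / P.den lam delta A)

/-- `L₁₂^{0-}`. -/
def L12Z (P : PhysParams) (lam : ℂ) (A : ℝ) : ℂ :=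
  -(P.muM : ℂ) * (P.rootBM lam A - A) * A

/-- `L₁₂^{b-}`. -/
def L12B (P : PhysParams) (lam : ℂ) (A : ℝ) : ℂ :=
  -(P.muM : ℂ) * (2 * (A : ℂ) ^ 2 * P.rootBM lam A * P.kerM lam A (-P.b)
    + (P.rootBM lam A - A) * A * P.expB lam A)

/-- `L₂₁⁺`. -/
def L21P (P : PhysParams) (lam delta : ℂ) (A : ℝ) : ℂ :=
  -(A : ℂ) * (2 * (P.muP : ℂ)
      * (P.rootAP lam delta A * (P.rootBP lam A - P.rootAP lam delta A) / P.den lam delta A)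
    - ((P.nuP : ℂ) - (P.muP : ℂ) + delta)
      * ((P.rootAP lam delta A ^ 2 - (A : ℂ) ^ 2) / P.den lam delta A))

/-- `L₂₁^{0-}`. -/
def L21Z (P : PhysParams) (lam : ℂ) (A : ℝ) : ℂ :=
  -(P.muM : ℂ) * (P.rootBM lam A - A)

/-- `L₂₁^{b-}`. -/
def L21B (P : PhysParams) (lam : ℂ) (A : ℝ) : ℂ :=
  2 * (P.muM : ℂ) * A * P.rootBM lam A * P.kerM lam A (-P.b)
    - (P.muM : ℂ) * (P.rootBM lam A - A) * P.expA A

/-- `L₂₂⁺`. -/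
def L22P (P : PhysParams) (lam delta : ℂ) (A : ℝ) : ℂ :=
  -((P.muP : ℂ) + (P.nuP : ℂ) + delta)
    * (A * P.rootBP lam A * (P.rootAP lam delta A ^ 2 - (A : ℂ) ^ 2) / P.den lam delta A)

/-- `L₂₂^{0-}`. -/
def L22Z (P : PhysParams) (lam : ℂ) (A : ℝ) : ℂ :=
  -(P.muM : ℂ) * (A + P.rootBM lam A) * P.rootBM lam A

/-- `L₂₂^{b-}`. -/
def L22B (P : PhysParams) (lam : ℂ) (A : ℝ) : ℂ :=
  -2 * (P.muM : ℂ) * (A : ℂ) ^ 2 * P.rootBM lam A * P.kerM lam A (-P.b)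
    + (P.muM : ℂ) * (P.rootBM lam A + A) * P.rootBM lam A * P.expA A

/-- `𝔏₁`. -/
def frakL1 (P : PhysParams) (lam delta : ℂ) (A : ℝ) : ℂ :=
  -(A * P.L11P lam delta A + P.L12P lam delta A) * (A + P.rootBM lam A)
      * P.kerM lam A (-P.b) ^ 2
    - P.L11B lam A * A * P.kerM lam A (-P.b) + P.L12B lam A * P.kerM lam A (-P.b)

/-- `𝔏₂`. -/
def frakL2 (P : PhysParams) (lam delta : ℂ) (A : ℝ) : ℂ :=
  -(A * P.L21P lam delta A + P.L22P lam delta A) * (A + P.rootBM lam A)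
      * P.kerM lam A (-P.b) ^ 2
    - P.L21B lam A * A * P.kerM lam A (-P.b) + P.L22B lam A * P.kerM lam A (-P.b)

/-- The factor `1 - e^{-2 B₋ b} - 2 e^{-B₋ b} A M₋(-b)` of the first column. -/
def colFactor1 (P : PhysParams) (lam : ℂ) (A : ℝ) : ℂ :=
  1 - P.expB lam A ^ 2 - 2 * P.expB lam A * A * P.kerM lam A (-P.b)

/-- The factor `1 - e^{-2 B₋ b} + 2 e^{-B₋ b} B₋ M₋(-b)` of the second column. -/
def colFactor2 (P : PhysParams) (lam : ℂ) (A : ℝ) : ℂ :=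
  1 - P.expB lam A ^ 2 + 2 * P.expB lam A * P.rootBM lam A * P.kerM lam A (-P.b)

/-- The interface matrix `𝐋 = (L_{kℓ})`. -/
def matL (P : PhysParams) (lam delta : ℂ) (A : ℝ) : Matrix (Fin 2) (Fin 2) ℂ :=
  !![P.L11P lam delta A * P.colFactor1 lam A + P.L11Z lam A - P.L11B lam A * P.expB lam A
        + P.frakL1 lam delta A,
     P.L12P lam delta A * P.colFactor2 lam A + P.L12Z lam A - P.L12B lam A * P.expB lam A
        + P.rootBM lam A * P.frakL1 lam delta A;
     P.L21P lam delta A * P.colFactor1 lam A + P.L21Z lam A - P.L21B lam A * P.expB lam A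
        + P.frakL2 lam delta A,
     P.L22P lam delta A * P.colFactor2 lam A + P.L22Z lam A - P.L22B lam A * P.expB lam A
        + P.rootBM lam A * P.frakL2 lam delta A]

end PhysParams

end

/-! The proof is an energy argument. For a fixed tangential frequency `A`, the matrix `𝐋` takes
parameters `h` of a Stokes solution in the layer, vanishing at the bottom, to a stress jump at the
interface. If `T` (`traceMat`) sends `h` to the interface velocity `g = T h`, then `𝐋 h = S g + s`,
where `S` gives the Lamé stress of the half-line solution with boundary value `g` and `s` is minus
the Stokes stress of the layer. Pairing with `g` gives the energies of both fluids.

These energies are complex, with coefficients `λ`, real viscosities and `ν₊ + δ`. The hypotheses on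
`(λ, δ)` serve to produce one `ω` with `Re ω = 1`, bounded norm, `Re (ωλ) ≥ c|λ|` and `Re (ω(ν₊ +
δ)) ≥ c` (`exists_rotation`). Then `Re (-ω ⟨𝐋 h, T h⟩) ≥ p|g₁|² + q|g₂|²` (`matL_coercive`), and
linear algebra yields `p q |det T| ≤ |ω|² |det 𝐋|`.

The half line contributes order `|λ|^{1/2} + A` to both weights. This is not enough, because `|det
T|` is bounded below only by a multiple of `A (1 - e^{-Ab})`, which is of order `A²` as `A → 0`.
Incompressibility with a no-slip bottom supplies the rest: the normal velocity at the interface is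
an integral of `A w₁`, so the layer energy controls `|λ| |g₂|² / A²`, and also `|λ| |g₂|² / A`, the
better bound for large `A` (`layer_energy`, `exists_flux_weight`).

The bound for `det T` splits into modes even and odd about mid-layer. It reduces to separating `B
tanh (Bb/2)` from `A tanh (Ab/2)`, and likewise for `coth`, which follows from a Dirichlet principle
(`impedance_comparison`). -/

noncomputable section

open Filter Topology ComplexConjugate

/-! ### Square roots and their real parts -/

/-- The principal square root squares to its argument. -/
theorem csqrt_sq (z : ℂ) : csqrt z ^ 2 = z := by
  unfold csqrt
  rw [← Complex.cpow_nat_mul]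
  norm_num

theorem csqrt_re_nonneg (z : ℂ) : 0 ≤ (csqrt z).re := by
  unfold csqrt
  by_cases hz : z = 0
  · subst hz
    rw [Complex.zero_cpow (by norm_num)]
    simp
  · rw [Complex.cpow_def_of_ne_zero hz, Complex.exp_re]
    have h2 : (Complex.log z * (1 / 2)).im = z.arg / 2 := by
      have : (1 / 2 : ℂ) = ((1 / 2 : ℝ) : ℂ) := by push_cast; rfl
      rw [this, Complex.im_mul_ofReal, Complex.log_im]; ring
    rw [h2]
    apply mul_nonneg (Real.exp_nonneg _)
    apply Real.cos_nonneg_of_neg_pi_div_two_le_of_le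
    · linarith [Complex.neg_pi_lt_arg z]
    · linarith [Complex.arg_le_pi z]

/-- A complex number with nonnegative real part whose square is not a nonpositive real lies in the
open right half-plane. -/
theorem re_pos_of_sq_ne {B : ℂ} (h0 : 0 ≤ B.re) (h : ∀ s : ℝ, 0 ≤ s → B ^ 2 ≠ -(s : ℂ)) :
    0 < B.re := by
  rcases h0.lt_or_eq with h1 | h1
  · exact h1
  · exfalso
    refine h (B.im ^ 2) (sq_nonneg _) ?_
    apply Complex.ext <;> simp [pow_two, ← h1]

/-- A rotated coercivity bound for `B²` bounds the real part of `B` from below. -/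
theorem re_mul_sq_le {ω B : ℂ} (hω : ω.re = 1) : (ω * B ^ 2).re ≤ ‖ω‖ ^ 2 * B.re ^ 2 := by
  rw [Complex.sq_norm, Complex.normSq_apply, hω]
  simp only [pow_two, Complex.mul_re, Complex.mul_im, hω]
  nlinarith [sq_nonneg (B.im + ω.im * B.re)]

/-! ### Determinants of coercive matrices -/

/-- A coercive `2 × 2` matrix has a determinant bounded from below. -/
theorem mul_le_norm_det_of_coercive {ω a b c d : ℂ} {p q : ℝ} (hp : 0 < p) (hq : 0 < q)
    (h : ∀ x y : ℂ, p * ‖x‖ ^ 2 + q * ‖y‖ ^ 2 ≤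
      (ω * ((a * x + b * y) * conj x + (c * x + d * y) * conj y)).re) :
    p * q ≤ ‖ω‖ ^ 2 * ‖a * d - b * c‖ := by
  have ha : p ≤ ‖ω‖ * ‖a‖ := by
    have := h 1 0
    simp only [norm_one, norm_zero, map_one, map_zero, mul_one, mul_zero, add_zero] at this
    have h2 := Complex.re_le_norm (ω * a)
    rw [norm_mul] at h2
    norm_num at this
    simp only [Complex.mul_re] at h2
    linarith
  have hapos : 0 < ‖a‖ := by
    rcases (norm_nonneg a).lt_or_eq with h1 | h1
    · exact h1
    · rw [← h1, mul_zero] at ha; linarith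
  have hd : q * ‖a‖ ≤ ‖ω‖ * ‖a * d - b * c‖ := by
    -- The first row annihilates `(-b, a)` and the second row sends it to the determinant.
    have h1 := h (-b) a
    have e : ω * ((a * -b + b * a) * conj (-b) + (c * -b + d * a) * conj a)
        = ω * (a * d - b * c) * conj a := by ring
    rw [e] at h1
    have h2 := Complex.re_le_norm (ω * (a * d - b * c) * conj a)
    rw [norm_mul, norm_mul, Complex.norm_conj] at h2
    have h3 : q * ‖a‖ * ‖a‖ ≤ ‖ω‖ * ‖a * d - b * c‖ * ‖a‖ := by
      have := mul_nonneg hp.le (sq_nonneg ‖-b‖)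
      nlinarith
    exact le_of_mul_le_mul_right h3 hapos
  calc p * q ≤ ‖ω‖ * ‖a‖ * q := by gcongr
    _ = ‖ω‖ * (q * ‖a‖) := by ring
    _ ≤ ‖ω‖ * (‖ω‖ * ‖a * d - b * c‖) := by gcongr
    _ = _ := by ring

/-- The determinant bound for a matrix `L` that is coercive relative to the change of unknowns
`T`. -/
theorem mul_norm_det_le_of_coercive {ω a b c d α β γ δ : ℂ} {p q : ℝ} (hp : 0 < p) (hq : 0 < q)
    (hT : α * δ - β * γ ≠ 0)
    (h : ∀ x y : ℂ, p * ‖α * x + β * y‖ ^ 2 + q * ‖γ * x + δ * y‖ ^ 2 ≤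
      (ω * ((a * x + b * y) * conj (α * x + β * y)
        + (c * x + d * y) * conj (γ * x + δ * y))).re) :
    p * q * ‖α * δ - β * γ‖ ≤ ‖ω‖ ^ 2 * ‖a * d - b * c‖ := by
  set τ := α * δ - β * γ with hτ
  have hτ0 : 0 < ‖τ‖ := norm_pos_iff.mpr hT
  -- Substituting the adjugate of `T` instead of its inverse avoids division: `T` times its adjugate
  -- is `τ`, and the factor `conj τ` moves into `ω`. The result carries `‖τ‖ ^ 4` on the left and
  -- `‖τ‖ ^ 3` on the right.
  have key := mul_le_norm_det_of_coercive (ω := ω * conj τ) (a := a * δ - b * γ)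
    (b := b * α - a * β) (c := c * δ - d * γ) (d := d * α - c * β) (p := ‖τ‖ ^ 2 * p)
    (q := ‖τ‖ ^ 2 * q) (by positivity) (by positivity) (by
      intro x y
      have h1 := h (δ * x - β * y) (α * y - γ * x)
      have e1 : α * (δ * x - β * y) + β * (α * y - γ * x) = τ * x := by rw [hτ]; ring
      have e2 : γ * (δ * x - β * y) + δ * (α * y - γ * x) = τ * y := by rw [hτ]; ring
      rw [e1, e2, norm_mul, norm_mul] at h1
      calc _ = p * (‖τ‖ * ‖x‖) ^ 2 + q * (‖τ‖ * ‖y‖) ^ 2 := by ring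
        _ ≤ _ := h1
        _ = _ := by
          congr 1
          simp only [map_mul]
          ring)
  have e : (a * δ - b * γ) * (d * α - c * β) - (b * α - a * β) * (c * δ - d * γ)
      = (a * d - b * c) * τ := by rw [hτ]; ring
  rw [e, norm_mul, norm_mul, Complex.norm_conj] at key
  have h3 : p * q * ‖τ‖ * ‖τ‖ ^ 3 ≤ ‖ω‖ ^ 2 * ‖a * d - b * c‖ * ‖τ‖ ^ 3 := by
    nlinarith
  exact le_of_mul_le_mul_right h3 (by positivity)

/-! ### Derivatives and monotonicity of energy functionals -/

theorem hasDerivAt_re_mul_conj {f g : ℝ → ℂ} {f' g' : ℂ} {x : ℝ} (ω : ℂ)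
    (hf : HasDerivAt f f' x) (hg : HasDerivAt g g' x) :
    HasDerivAt (fun y => (ω * (f y * conj (g y))).re)
      ((ω * (f' * conj (g x) + f x * conj g')).re) x := by
  have h1 : HasDerivAt (fun y => conj (g y)) (conj g') x := hg.star
  have h2 := (hf.mul h1).const_mul ω
  exact Complex.reCLM.hasFDerivAt.comp_hasDerivAt x h2

theorem hasDerivAt_norm_sq {f : ℝ → ℂ} {f' : ℂ} {x : ℝ} (hf : HasDerivAt f f' x) :
    HasDerivAt (fun y => ‖f y‖ ^ 2) (2 * (f' * conj (f x)).re) x := by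
  have h := hasDerivAt_re_mul_conj 1 hf hf
  have e : (fun y => ((1 : ℂ) * (f y * conj (f y))).re) = fun y => ‖f y‖ ^ 2 := by
    funext y
    rw [one_mul, Complex.mul_conj, Complex.ofReal_re, Complex.normSq_eq_norm_sq]
  rw [e] at h
  convert h using 1
  simp only [one_mul, Complex.add_re, Complex.mul_re, Complex.conj_re, Complex.conj_im]
  ring

/-- A function with nonnegative derivative that tends to `0` at `+∞` is nonpositive. -/
theorem nonpos_of_deriv_nonneg_of_tendsto_zero {G G' : ℝ → ℝ} (h : ∀ x, HasDerivAt G (G' x) x)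
    (h' : ∀ x, 0 ≤ G' x) (hG : Tendsto G atTop (𝓝 0)) (x : ℝ) : G x ≤ 0 :=
  (monotone_of_hasDerivAt_nonneg h h').ge_of_tendsto hG x

/-- A function with nonnegative derivative on an interval grows along it. -/
theorem le_of_hasDerivAt_nonneg {G G' : ℝ → ℝ} {a b : ℝ} (hab : a ≤ b)
    (h : ∀ x ∈ Set.Icc a b, HasDerivAt G (G' x) x)
    (h' : ∀ x ∈ Set.Icc a b, 0 ≤ G' x) : G a ≤ G b := by
  have hm : MonotoneOn G (Set.Icc a b) := by
    apply monotoneOn_of_hasDerivWithinAt_nonneg (convex_Icc a b) (f' := G')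
    · exact fun x hx => (h x hx).continuousAt.continuousWithinAt
    · exact fun x hx => (h x (interior_subset hx)).hasDerivWithinAt
    · exact fun x hx => h' x (interior_subset hx)
  exact hm (Set.left_mem_Icc.mpr hab) (Set.right_mem_Icc.mpr hab) hab

/-! ### Rotating the coefficients into a common half-plane -/

theorem re_ge_of_mem_sectorSet {ε : ℝ} (hε : 0 < ε) {z : ℂ} (hz : z ∈ sectorSet ε) :
    -(Real.cos ε * ‖z‖) ≤ z.re := by
  obtain ⟨h0, h1⟩ := hz
  have h2 : Real.cos (Real.pi - ε) ≤ Real.cos |z.arg| :=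
    Real.cos_le_cos_of_nonneg_of_le_pi (abs_nonneg _) (by linarith) h1
  rw [Real.cos_abs, Complex.cos_arg h0, Real.cos_pi_sub] at h2
  have hn : 0 < ‖z‖ := norm_pos_iff.mpr h0
  rw [le_div_iff₀ hn] at h2
  linarith

/-- On `Σ_ε`, away from the right half-plane, the imaginary part dominates. -/
theorem abs_im_ge_of_mem_sectorSet {ε : ℝ} (hε : 0 < ε) (hε' : ε < Real.pi / 2) :
    ∃ s : ℝ, 0 < s ∧ ∀ z ∈ sectorSet ε, z.re ≤ ‖z‖ / 2 → s * ‖z‖ ≤ |z.im| := by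
  have hc0 : 0 < Real.cos ε := Real.cos_pos_of_mem_Ioo ⟨by linarith, hε'⟩
  have hc1 : Real.cos ε < 1 := by
    have := Real.cos_lt_cos_of_nonneg_of_le_pi_div_two le_rfl hε'.le hε
    rwa [Real.cos_zero] at this
  set k := max (Real.cos ε) (1 / 2) with hk
  have hk1 : k < 1 := max_lt hc1 (by norm_num)
  have hk0 : 0 < k := lt_max_of_lt_right (by norm_num)
  refine ⟨1 - k, by linarith, fun z hz hre => ?_⟩
  have h1 := re_ge_of_mem_sectorSet hε hz
  have hn := norm_nonneg z
  have h2 : |z.re| ≤ k * ‖z‖ := by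
    rw [abs_le]
    constructor
    · have : Real.cos ε * ‖z‖ ≤ k * ‖z‖ := by gcongr; exact le_max_left _ _
      linarith
    · have : (1 / 2) * ‖z‖ ≤ k * ‖z‖ := by gcongr; exact le_max_right _ _
      linarith
  have h3 := Complex.norm_le_abs_re_add_abs_im z
  linarith

/-- With `g = γ₁₊γ₂₊` and `r = g/ν₊ + ε`, membership in `K_ε` reads `2 r Re λ ≥ -|λ|²`, hence `ν₊ +
2 g Re λ/|λ|² ≥ ν₊ - g/r > 0`. The factor 2 is what a rotation needs: if `Re λ < c|λ|`, choosing `t`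
with `Re λ + t Im λ = c|λ|` turns `Re δ + t Im δ` into `2 g Re λ/|λ|² - c g/|λ|`. If `Re λ ≥ c|λ|`,
then `t = 0` works. -/
theorem exists_rotation_caseC1 (P : PhysParams) (hP : P.Positive) {ε lam0 : ℝ}
    (hε : 0 < ε) (hε' : ε < Real.pi / 2) (hlam0 : 0 < lam0) :
    ∃ c K : ℝ, 0 < c ∧ 0 ≤ K ∧ ∀ lam delta : ℂ, P.CaseC1 ε lam0 lam delta →
      ∃ t : ℝ, |t| ≤ K ∧ c * ‖lam‖ ≤ lam.re + t * lam.im ∧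
        c ≤ P.nuP + delta.re + t * delta.im := by
  obtain ⟨s, hs, hsec⟩ := abs_im_ge_of_mem_sectorSet hε hε'
  have hnu := hP.nuP_pos
  set g := P.gam1P * P.gam2P with hg
  have hg0 : 0 < g := mul_pos hP.gam1P_pos hP.gam2P_pos
  set r := g * P.nuP⁻¹ + ε with hr
  have hr0 : 0 < r := by positivity
  set η := P.nuP - g / r with hη
  have hη0 : 0 < η := by
    rw [hη, sub_pos, div_lt_iff₀ hr0, hr]
    have : P.nuP * (g * P.nuP⁻¹ + ε) = g + P.nuP * ε := by field_simp
    rw [this]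
    have := mul_pos hnu hε
    linarith
  -- The bound `1/2` makes the sector estimate for `Im λ` available whenever `Re λ < c|λ|`; the
  -- other bound keeps the loss `c g/|λ|` below `η/2`.
  set c := min (1 / 2) (η * lam0 / (2 * g)) with hc
  have hc0 : 0 < c := lt_min (by norm_num) (by positivity)
  have hc2 : c ≤ 1 / 2 := min_le_left _ _
  have hc3 : c * (g / lam0) ≤ η / 2 := by
    calc c * (g / lam0) ≤ (η * lam0 / (2 * g)) * (g / lam0) := by
          gcongr; exact min_le_right _ _
      _ = η / 2 := by field_simp
  refine ⟨min c (min (η / 2) P.nuP), 2 / s, by positivity, by positivity, ?_⟩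
  rintro lam delta ⟨⟨⟨hlam, hl0⟩, hK⟩, rfl⟩
  have hn : 0 < ‖lam‖ := lt_of_lt_of_le hlam0 hl0
  have hns : ‖lam‖ ^ 2 = lam.re ^ 2 + lam.im ^ 2 := by
    rw [Complex.sq_norm, Complex.normSq_apply]; ring
  have hre : ((P.gam1P : ℂ) * (P.gam2P : ℂ) * lam⁻¹).re = g * lam.re / ‖lam‖ ^ 2 := by
    rw [← Complex.ofReal_mul, Complex.re_ofReal_mul, Complex.inv_re, Complex.normSq_eq_norm_sq]
    ring
  have him : ((P.gam1P : ℂ) * (P.gam2P : ℂ) * lam⁻¹).im = -(g * lam.im / ‖lam‖ ^ 2) := by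
    rw [← Complex.ofReal_mul, Complex.im_ofReal_mul, Complex.inv_im, Complex.normSq_eq_norm_sq]
    ring
  rw [hre, him]
  have hm1 : min c (min (η / 2) P.nuP) ≤ c := min_le_left _ _
  have hm2 : min c (min (η / 2) P.nuP) ≤ η / 2 := (min_le_right _ _).trans (min_le_left _ _)
  have hm3 : min c (min (η / 2) P.nuP) ≤ P.nuP := (min_le_right _ _).trans (min_le_right _ _)
  have hKK : -(‖lam‖ ^ 2) ≤ 2 * r * lam.re := by
    have : (g * P.nuP⁻¹ + ε) ^ 2 ≤ (lam.re + g * P.nuP⁻¹ + ε) ^ 2 + lam.im ^ 2 := hK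
    rw [add_assoc lam.re, ← hr] at this
    nlinarith
  have hKη : η ≤ P.nuP + 2 * (g * lam.re / ‖lam‖ ^ 2) := by
    have : -(g / r) ≤ 2 * (g * lam.re / ‖lam‖ ^ 2) := by
      rw [← mul_div_assoc, ← neg_div, div_le_div_iff₀ hr0 (by positivity)]
      nlinarith
    rw [hη]; linarith
  by_cases hcase : c * ‖lam‖ ≤ lam.re
  · refine ⟨0, by rw [abs_zero]; positivity, ?_, ?_⟩
    · rw [zero_mul, add_zero]
      exact le_trans (by gcongr) hcase
    · have : 0 ≤ g * lam.re / ‖lam‖ ^ 2 := by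
        have : 0 ≤ lam.re := le_trans (by positivity) hcase
        positivity
      linarith
  · push Not at hcase
    have him_ge : s * ‖lam‖ ≤ |lam.im| := hsec lam hlam (by nlinarith)
    have him0 : lam.im ≠ 0 := by
      intro h; rw [h, abs_zero] at him_ge
      have := mul_pos hs hn
      linarith
    refine ⟨(c * ‖lam‖ - lam.re) / lam.im, ?_, ?_, ?_⟩
    · rw [abs_div, div_le_div_iff₀ (abs_pos.mpr him0) hs]
      have h1 : |c * ‖lam‖ - lam.re| ≤ 2 * ‖lam‖ := by
        have := Complex.abs_re_le_norm lam
        rw [abs_le] at this ⊢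
        constructor <;> nlinarith
      calc |c * ‖lam‖ - lam.re| * s ≤ 2 * ‖lam‖ * s := by gcongr
        _ = 2 * (s * ‖lam‖) := by ring
        _ ≤ _ := by gcongr
    · rw [div_mul_cancel₀ _ him0]
      have : min c (min (η / 2) P.nuP) * ‖lam‖ ≤ c * ‖lam‖ := by gcongr
      linarith
    · have e : (c * ‖lam‖ - lam.re) / lam.im * -(g * lam.im / ‖lam‖ ^ 2)
          = -(c * (g / ‖lam‖)) + g * lam.re / ‖lam‖ ^ 2 := by
        field_simp
        ring
      have h1 : c * (g / ‖lam‖) ≤ c * (g / lam0) := by gcongr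
      rw [e]
      linarith

/-- The choice `t = -Re δ/Im δ` cancels `Re δ` and leaves `Re λ + t Im λ ≥ 0` by the cone condition.
Adding `σ` times the sign of `Im λ` gains `σ|Im λ|` and costs at most `σ δ₀ = ν/2` in the other
inequality. -/
theorem exists_rotation_caseC2 {nu ε lam0 delta0 : ℝ} (hnu : 0 < nu)
    (hε : 0 < ε) (hε' : ε < Real.pi / 2) (hdelta0 : 0 < delta0) :
    ∃ c K : ℝ, 0 < c ∧ 0 ≤ K ∧ ∀ lam delta : ℂ, CaseC2 ε lam0 delta0 lam delta →
      ∃ t : ℝ, |t| ≤ K ∧ c * ‖lam‖ ≤ lam.re + t * lam.im ∧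
        c ≤ nu + delta.re + t * delta.im := by
  obtain ⟨s, hs, hsec⟩ := abs_im_ge_of_mem_sectorSet hε hε'
  set σ := nu / (2 * delta0) with hσ
  have hσ0 : 0 < σ := by positivity
  -- Only the fraction `θ` of the cone inequality is used, so that the loss `θ q |Im λ|`, with `q ≤
  -- 1/s`, is at most half of the gain `σ|Im λ|`.
  set θ := min 1 (s * (σ / 2)) with hθ
  have hθ0 : 0 < θ := by positivity
  have hθ1 : θ ≤ 1 := min_le_left _ _
  have hθ2 : θ * (1 / s) ≤ σ / 2 := by
    calc θ * (1 / s) ≤ (s * (σ / 2)) * (1 / s) := by gcongr; exact min_le_right _ _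
      _ = σ / 2 := by field_simp
  refine ⟨min (nu / 2) (min θ (σ / 2)), 1 / s + σ, by positivity, by positivity, ?_⟩
  rintro lam delta ⟨hδ, hre, hδ0, -, hlam⟩
  have hδn : 0 < ‖delta‖ := norm_pos_iff.mpr hδ.1
  have him_ge : s * ‖delta‖ ≤ |delta.im| := hsec delta hδ (by linarith)
  have him0 : delta.im ≠ 0 := by
    intro h; rw [h, abs_zero] at him_ge
    have := mul_pos hs hδn
    linarith
  set q := |delta.re / delta.im| with hq
  have hq0 : 0 ≤ q := abs_nonneg _
  have hqs : q ≤ 1 / s := by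
    rw [hq, abs_div, div_le_div_iff₀ (abs_pos.mpr him0) hs]
    have := Complex.abs_re_le_norm delta
    nlinarith
  obtain ⟨sg, hsg1, hsg2⟩ : ∃ sg : ℝ, |sg| = 1 ∧ sg * lam.im = |lam.im| := by
    rcases le_total 0 lam.im with h | h
    · exact ⟨1, by simp, by rw [abs_of_nonneg h, one_mul]⟩
    · exact ⟨-1, by simp, by rw [abs_of_nonpos h]; ring⟩
  have hm1 : min (nu / 2) (min θ (σ / 2)) ≤ nu / 2 := min_le_left _ _
  have hm2 : min (nu / 2) (min θ (σ / 2)) ≤ θ := (min_le_right _ _).trans (min_le_left _ _)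
  have hm3 : min (nu / 2) (min θ (σ / 2)) ≤ σ / 2 := (min_le_right _ _).trans (min_le_right _ _)
  set m := min (nu / 2) (min θ (σ / 2)) with hm
  have hm0 : 0 < m := by positivity
  refine ⟨-(delta.re / delta.im) + σ * sg, ?_, ?_, ?_⟩
  · calc |-(delta.re / delta.im) + σ * sg| ≤ |-(delta.re / delta.im)| + |σ * sg| := abs_add_le _ _
      _ = q + σ := by rw [abs_neg, abs_mul, hsg1, abs_of_pos hσ0, mul_one]
      _ ≤ _ := by gcongr
  · have h1 : -(q * |lam.im|) ≤ -(delta.re / delta.im) * lam.im := by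
      rw [hq, ← abs_mul, neg_mul]
      exact neg_le_neg (le_abs_self _)
    have h2 : 0 ≤ lam.re := le_trans (by positivity) hlam
    have h3 := Complex.norm_le_abs_re_add_abs_im lam
    rw [abs_of_nonneg h2] at h3
    have hY := abs_nonneg lam.im
    have h4 : m * ‖lam‖ ≤ θ * lam.re + σ / 2 * |lam.im| := by
      calc m * ‖lam‖ ≤ m * (lam.re + |lam.im|) := by gcongr
        _ = m * lam.re + m * |lam.im| := by ring
        _ ≤ _ := by gcongr
    have h5 : θ * (lam.re - q * |lam.im|) ≤ 1 * (lam.re - q * |lam.im|) := by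
      have : 0 ≤ lam.re - q * |lam.im| := by linarith
      gcongr
    have h6 : θ * q * |lam.im| ≤ σ / 2 * |lam.im| := by
      have : θ * q ≤ σ / 2 := le_trans (by gcongr) hθ2
      gcongr
    calc m * ‖lam‖ ≤ lam.re + -(q * |lam.im|) + σ * |lam.im| := by nlinarith
      _ ≤ lam.re + -(delta.re / delta.im) * lam.im + σ * (sg * lam.im) := by
        rw [hsg2]; linarith
      _ = _ := by ring
  · have e : (-(delta.re / delta.im) + σ * sg) * delta.im = -delta.re + σ * (sg * delta.im) := by
      field_simp
    have h1 : -delta0 ≤ sg * delta.im := by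
      have h2 : |sg * delta.im| ≤ delta0 := by
        rw [abs_mul, hsg1, one_mul]
        exact (Complex.abs_im_le_norm delta).trans hδ0
      exact (abs_le.mp h2).1
    have h3 : σ * -delta0 ≤ σ * (sg * delta.im) := by gcongr
    have h4 : σ * delta0 = nu / 2 := by rw [hσ]; field_simp
    rw [e]
    linarith

theorem exists_rotation_caseC3 {nu ε lam0 delta0 : ℝ} (hnu : 0 < nu) (hlam0 : 0 < lam0) :
    ∃ c K : ℝ, 0 < c ∧ 0 ≤ K ∧ ∀ lam delta : ℂ, CaseC3 ε lam0 delta0 lam delta →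
      ∃ t : ℝ, |t| ≤ K ∧ c * ‖lam‖ ≤ lam.re + t * lam.im ∧
        c ≤ nu + delta.re + t * delta.im := by
  refine ⟨min nu (lam0 / (1 + lam0)), 0, by positivity, le_rfl, ?_⟩
  rintro lam delta ⟨-, hre, -, -, hlam⟩
  refine ⟨0, by simp, ?_, ?_⟩
  · have h2 : 0 ≤ lam.re := le_trans (by positivity) hlam
    have h3 := Complex.norm_le_abs_re_add_abs_im lam
    rw [abs_of_nonneg h2] at h3
    calc min nu (lam0 / (1 + lam0)) * ‖lam‖ ≤ lam0 / (1 + lam0) * (lam.re + |lam.im|) := by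
          gcongr; exact min_le_right _ _
      _ ≤ lam.re := by
          rw [div_mul_eq_mul_div, div_le_iff₀ (by positivity)]
          nlinarith
      _ = _ := by ring
  · have := min_le_left nu (lam0 / (1 + lam0))
    linarith

/-- The coefficients `λ`, `1` and `ν₊ + δ` of the energy form lie uniformly in a common rotated
half-plane. -/
theorem exists_rotation (P : PhysParams) (hP : P.Positive) {ε lam0 delta0 : ℝ}
    (hε : 0 < ε) (hε' : ε < Real.pi / 2) (hlam0 : 0 < lam0) (hdelta0 : 0 < delta0) :
    ∃ c K : ℝ, 0 < c ∧ 0 < K ∧ ∀ lam delta : ℂ, P.MemGamma ε lam0 delta0 lam delta →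
      lam0 ≤ ‖lam‖ ∧ ∃ ω : ℂ, ω.re = 1 ∧ ‖ω‖ ≤ K ∧ c * ‖lam‖ ≤ (ω * lam).re ∧
        c ≤ (ω * (P.nuP + delta)).re := by
  obtain ⟨c1, K1, hc1, hK1, h1⟩ := exists_rotation_caseC1 P hP hε hε' hlam0
  obtain ⟨c2, K2, hc2, hK2, h2⟩ :=
    exists_rotation_caseC2 (lam0 := lam0) hP.nuP_pos hε hε' hdelta0
  obtain ⟨c3, K3, hc3, hK3, h3⟩ :=
    exists_rotation_caseC3 (ε := ε) (delta0 := delta0) hP.nuP_pos hlam0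
  refine ⟨min c1 (min c2 c3), 1 + (K1 + K2 + K3), by positivity, by positivity, ?_⟩
  intro lam delta h
  have hm1 : min c1 (min c2 c3) ≤ c1 := min_le_left _ _
  have hm2 : min c1 (min c2 c3) ≤ c2 := (min_le_right _ _).trans (min_le_left _ _)
  have hm3 : min c1 (min c2 c3) ≤ c3 := (min_le_right _ _).trans (min_le_right _ _)
  have hl : lam0 ≤ ‖lam‖ := by
    rcases h with h | h | h
    · exact h.1.1.2
    · exact h.2.2.2.1
    · exact h.2.2.2.1
  refine ⟨hl, ?_⟩
  have main : ∃ t : ℝ, |t| ≤ K1 + K2 + K3 ∧ min c1 (min c2 c3) * ‖lam‖ ≤ lam.re + t * lam.im ∧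
      min c1 (min c2 c3) ≤ P.nuP + delta.re + t * delta.im := by
    have hn := norm_nonneg lam
    rcases h with h | h | h
    · obtain ⟨t, ht, ha, hb⟩ := h1 lam delta h
      exact ⟨t, by linarith, le_trans (by gcongr) ha, hm1.trans hb⟩
    · obtain ⟨t, ht, ha, hb⟩ := h2 lam delta h
      exact ⟨t, by linarith, le_trans (by gcongr) ha, hm2.trans hb⟩
    · obtain ⟨t, ht, ha, hb⟩ := h3 lam delta h
      exact ⟨t, by linarith, le_trans (by gcongr) ha, hm3.trans hb⟩
  obtain ⟨t, ht, ha, hb⟩ := main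
  -- For `ω = 1 - i t` one has `Re (ω z) = Re z + t Im z`.
  refine ⟨⟨1, -t⟩, rfl, ?_, ?_, ?_⟩
  · refine (Complex.norm_le_abs_re_add_abs_im _).trans ?_
    simpa using ht
  · simpa [Complex.mul_re] using ha
  · simpa [Complex.mul_re] using hb

/-! ### Energy estimates on the half line and in the layer -/

/-- Completed squares behind the boundary form `A (4/3) (a₁² + a₁ a₂ + a₂²)` of the half line. -/
theorem korn_completed_squares (A a1 a2 p1 p2 : ℝ) :
    0 ≤ (p1 - A * a2) ^ 2 + 2 * A ^ 2 * a1 ^ 2 + 2 * p2 ^ 2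
      + A * (4 / 3) * (2 * a1 * p1 + a1 * p2 + a2 * p1 + 2 * a2 * p2) := by
  have : (p1 - A * a2) ^ 2 + 2 * A ^ 2 * a1 ^ 2 + 2 * p2 ^ 2
      + A * (4 / 3) * (2 * a1 * p1 + a1 * p2 + a2 * p1 + 2 * a2 * p2)
      = (p1 - A * a2 + A * (4 / 3 * a1 + 2 / 3 * a2)) ^ 2
        + 2 * (p2 + A * (1 / 3 * a1 + 2 / 3 * a2)) ^ 2 := by ring
  rw [this]
  positivity

/-- Writing `p1 = (p1 - A a2) + A a2` leaves the cross term `ρ A a1 a2`, which the square of `A a1 +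
ρ a2` absorbs; the other products pair off directly. -/
theorem trace_completed_squares (A ρ a1 a2 p1 p2 : ℝ) :
    0 ≤ 2 * (ρ ^ 2 * (a1 ^ 2 + a2 ^ 2) + (p1 - A * a2) ^ 2 + 2 * A ^ 2 * a1 ^ 2 + 2 * p2 ^ 2)
      + 2 * ρ * (a1 * p1 + a2 * p2) := by
  nlinarith [sq_nonneg (p1 - A * a2 + ρ * a1), sq_nonneg (A * a1 + ρ * a2),
    sq_nonneg (p2 + ρ * a2), sq_nonneg (p1 - A * a2), sq_nonneg (A * a1), sq_nonneg p2,
    sq_nonneg (ρ * a1)]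

/-- Half of the first inequality plus a quarter of the second spends the strain energy exactly once,
and buys boundary terms of sizes `A` and `ρ` together. -/
theorem boundary_completed_squares {A ρ a1 a2 p1 p2 : ℝ} :
    -(A * (2 / 3) * (2 * a1 * p1 + a1 * p2 + a2 * p1 + 2 * a2 * p2)
      + ρ / 2 * (a1 * p1 + a2 * p2)) ≤
    ρ ^ 2 * (a1 ^ 2 + a2 ^ 2) + (p1 - A * a2) ^ 2 + 2 * A ^ 2 * a1 ^ 2 + 2 * p2 ^ 2 := by
  have h1 := korn_completed_squares A a1 a2 p1 p2
  have h2 := trace_completed_squares A ρ a1 a2 p1 p2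
  have h3 : 0 ≤ ρ ^ 2 * (a1 ^ 2 + a2 ^ 2) := by positivity
  linarith

/-- Energy estimate for the compressible Lamé system on a half line. -/
theorem halfLine_energy {A μ γ c : ℝ} {lam κ ω : ℂ} {v1 v2 p1 p2 τ1 τ2 : ℝ → ℂ}
    (hA : 0 < A) (hc : 0 < c) (hω : ω.re = 1) (hμ : c ≤ μ)
    (hlam : c * ‖lam‖ ≤ γ * (ω * lam).re) (hκ : c ≤ (ω * κ).re)
    (dv1 : ∀ x, HasDerivAt v1 (p1 x) x) (dv2 : ∀ x, HasDerivAt v2 (p2 x) x)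
    (eτ1 : ∀ x, τ1 x = μ * (p1 x - A * v2 x))
    (eτ2 : ∀ x, τ2 x = 2 * μ * p2 x + (κ - μ) * (A * v1 x + p2 x))
    (dτ1 : ∀ x, HasDerivAt τ1
      (γ * lam * v1 x + A * (2 * μ * A * v1 x + (κ - μ) * (A * v1 x + p2 x))) x)
    (dτ2 : ∀ x, HasDerivAt τ2 (γ * lam * v2 x - A * τ1 x) x)
    (tv1 : Tendsto v1 atTop (𝓝 0)) (tv2 : Tendsto v2 atTop (𝓝 0))
    (tτ1 : Tendsto τ1 atTop (𝓝 0)) (tτ2 : Tendsto τ2 atTop (𝓝 0)) :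
    c / 4 * (√‖lam‖ + A) * (‖v1 0‖ ^ 2 + ‖v2 0‖ ^ 2) ≤
      -(ω * (τ1 0 * conj (v1 0) + τ2 0 * conj (v2 0))).re := by
  set ρ := √‖lam‖ with hρ
  have hρ2 : ρ ^ 2 = ‖lam‖ := Real.sq_sqrt (norm_nonneg _)
  have hρ0 : 0 ≤ ρ := Real.sqrt_nonneg _
  -- The functional is the rotated energy flux plus the boundary forms to be gained. It increases
  -- and tends to `0` at infinity, so it is nonpositive at `0`; monotonicity replaces integration by
  -- parts.
  have hd : ∀ x, HasDerivAt (fun x => (ω * (τ1 x * conj (v1 x))).re + (ω * (τ2 x * conj (v2 x))).re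
      + c * (A * (2 / 3) * (‖v1 x‖ ^ 2 + (1 * (v1 x * conj (v2 x))).re + ‖v2 x‖ ^ 2)
        + ρ / 4 * (‖v1 x‖ ^ 2 + ‖v2 x‖ ^ 2))) _ x := fun x =>
    ((hasDerivAt_re_mul_conj ω (dτ1 x) (dv1 x)).add
      (hasDerivAt_re_mul_conj ω (dτ2 x) (dv2 x))).add
      (((((hasDerivAt_norm_sq (dv1 x)).add (hasDerivAt_re_mul_conj 1 (dv1 x) (dv2 x))).add
        (hasDerivAt_norm_sq (dv2 x))).const_mul (A * (2 / 3))).add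
        (((hasDerivAt_norm_sq (dv1 x)).add (hasDerivAt_norm_sq (dv2 x))).const_mul (ρ / 4))
        |>.const_mul c)
  have tn : ∀ {f : ℝ → ℂ}, Tendsto f atTop (𝓝 0) → Tendsto (fun x => ‖f x‖ ^ 2) atTop (𝓝 0) := by
    intro f hf
    have := hf.norm.pow 2
    simpa using this
  have tm : ∀ {f g : ℝ → ℂ} (w : ℂ), Tendsto f atTop (𝓝 0) → Tendsto g atTop (𝓝 0) →
      Tendsto (fun x => (w * (f x * conj (g x))).re) atTop (𝓝 0) := by
    intro f g w hf hg
    have h1 : Tendsto (fun x => conj (g x)) atTop (𝓝 0) := by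
      have := (Complex.continuous_conj.tendsto 0).comp hg
      simpa [Function.comp_def] using this
    have h2 := (hf.mul h1).const_mul w
    have := (Complex.continuous_re.tendsto _).comp h2
    rw [mul_zero, mul_zero, Complex.zero_re] at this
    exact this
  have ht : Tendsto (fun x => (ω * (τ1 x * conj (v1 x))).re + (ω * (τ2 x * conj (v2 x))).re
      + c * (A * (2 / 3) * (‖v1 x‖ ^ 2 + (1 * (v1 x * conj (v2 x))).re + ‖v2 x‖ ^ 2)
        + ρ / 4 * (‖v1 x‖ ^ 2 + ‖v2 x‖ ^ 2))) atTop (𝓝 0) := by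
    have := ((tm ω tτ1 tv1).add (tm ω tτ2 tv2)).add
      (((((tn tv1).add (tm 1 tv1 tv2)).add (tn tv2)).const_mul (A * (2 / 3))).add
        (((tn tv1).add (tn tv2)).const_mul (ρ / 4)) |>.const_mul c)
    simpa using this
  have key := nonpos_of_deriv_nonneg_of_tendsto_zero hd (fun x => ?_) ht 0
  · have h1 : 0 ≤ ‖v1 0‖ ^ 2 / 2 + (1 * (v1 0 * conj (v2 0))).re + ‖v2 0‖ ^ 2 / 2 := by
      have := Complex.abs_re_le_norm (1 * (v1 0 * conj (v2 0)))
      rw [one_mul, norm_mul, Complex.norm_conj] at this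
      rw [one_mul]
      have := (abs_le.mp this).1
      nlinarith [sq_nonneg (‖v1 0‖ - ‖v2 0‖)]
    have h2 : c * (A / 4 * (‖v1 0‖ ^ 2 + ‖v2 0‖ ^ 2)) ≤
        c * (A * (2 / 3) * (‖v1 0‖ ^ 2 + (1 * (v1 0 * conj (v2 0))).re + ‖v2 0‖ ^ 2)) := by
      have h3 : 0 ≤ ‖v1 0‖ ^ 2 + ‖v2 0‖ ^ 2 := by positivity
      have : A / 4 * (‖v1 0‖ ^ 2 + ‖v2 0‖ ^ 2) ≤
        A * (2 / 3) * (‖v1 0‖ ^ 2 + (1 * (v1 0 * conj (v2 0))).re + ‖v2 0‖ ^ 2) := by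
        have : 1 / 4 * (‖v1 0‖ ^ 2 + ‖v2 0‖ ^ 2) ≤
          (2 / 3) * (‖v1 0‖ ^ 2 + (1 * (v1 0 * conj (v2 0))).re + ‖v2 0‖ ^ 2) := by linarith
        nlinarith
      gcongr
    rw [mul_add ω, Complex.add_re]
    nlinarith
  · have b1 := boundary_completed_squares (A := A) (ρ := ρ) (a1 := (v1 x).re) (a2 := (v2 x).re)
      (p1 := (p1 x).re) (p2 := (p2 x).re)
    have b2 := boundary_completed_squares (A := A) (ρ := ρ) (a1 := (v1 x).im) (a2 := (v2 x).im)
      (p1 := (p1 x).im) (p2 := (p2 x).im)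
    -- The strain splits into shear, deviatoric part and divergence. Since `Re ω = 1`, the real
    -- viscosity `μ` is unaffected by the rotation.
    have id1 : (ω * ((γ * lam * v1 x + A * (2 * μ * A * v1 x + (κ - μ) * (A * v1 x + p2 x)))
          * conj (v1 x) + τ1 x * conj (p1 x))).re
        + (ω * ((γ * lam * v2 x - A * τ1 x) * conj (v2 x) + τ2 x * conj (p2 x))).re
        = γ * (ω * lam).re * (‖v1 x‖ ^ 2 + ‖v2 x‖ ^ 2)
          + μ * (‖p1 x - A * v2 x‖ ^ 2 + ‖A * v1 x - p2 x‖ ^ 2)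
          + (ω * κ).re * ‖A * v1 x + p2 x‖ ^ 2 := by
      rw [eτ1, eτ2]
      simp only [Complex.sq_norm, Complex.normSq_apply]
      simp [hω]
      ring
    have hV : 0 ≤ ‖v1 x‖ ^ 2 + ‖v2 x‖ ^ 2 := by positivity
    have lb : c * (‖lam‖ * (‖v1 x‖ ^ 2 + ‖v2 x‖ ^ 2) + ‖p1 x - A * v2 x‖ ^ 2
          + ‖A * v1 x - p2 x‖ ^ 2 + ‖A * v1 x + p2 x‖ ^ 2)
        ≤ γ * (ω * lam).re * (‖v1 x‖ ^ 2 + ‖v2 x‖ ^ 2)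
          + μ * (‖p1 x - A * v2 x‖ ^ 2 + ‖A * v1 x - p2 x‖ ^ 2)
          + (ω * κ).re * ‖A * v1 x + p2 x‖ ^ 2 := by
      have := mul_le_mul_of_nonneg_right hlam hV
      have h2 : c * (‖p1 x - A * v2 x‖ ^ 2 + ‖A * v1 x - p2 x‖ ^ 2) ≤
        μ * (‖p1 x - A * v2 x‖ ^ 2 + ‖A * v1 x - p2 x‖ ^ 2) := by gcongr
      have h3 : c * ‖A * v1 x + p2 x‖ ^ 2 ≤ (ω * κ).re * ‖A * v1 x + p2 x‖ ^ 2 := by gcongr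
      linarith
    rw [id1]
    refine le_trans ?_ (add_le_add_left lb _)
    rw [← mul_add]
    apply mul_nonneg hc.le
    rw [← hρ2]
    simp only [Complex.sq_norm, Complex.normSq_apply]
    simp
    linarith

/-- Energy estimate for the Stokes system in a layer with a no-slip bottom. -/
theorem layer_energy {A μ γ c b : ℝ} {lam ω : ℂ} {w1 w2 p1 p2 q σ1 σ2 : ℝ → ℂ}
    (hA : 0 < A) (hb : 0 < b) (hc : 0 < c) (hω : ω.re = 1) (hμ : 0 ≤ μ)
    (hlam : c * ‖lam‖ ≤ γ * (ω * lam).re)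
    (dw1 : ∀ x, HasDerivAt w1 (p1 x) x) (dw2 : ∀ x, HasDerivAt w2 (p2 x) x)
    (hdiv : ∀ x, p2 x = -(A * w1 x))
    (eσ1 : ∀ x, σ1 x = μ * (p1 x - A * w2 x))
    (eσ2 : ∀ x, σ2 x = 2 * μ * p2 x - q x)
    (dσ1 : ∀ x, HasDerivAt σ1 (γ * lam * w1 x + A * (2 * μ * A * w1 x - q x)) x)
    (dσ2 : ∀ x, HasDerivAt σ2 (γ * lam * w2 x - A * σ1 x) x)
    (hw1 : w1 (-b) = 0) (hw2 : w2 (-b) = 0) :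
    c * ‖lam‖ * ‖w2 0‖ ^ 2 ≤ A * (ω * (σ1 0 * conj (w1 0) + σ2 0 * conj (w2 0))).re ∧
    c * ‖lam‖ * ‖w2 0‖ ^ 2 ≤ Real.exp 1 * b * A ^ 2 *
      (ω * (σ1 0 * conj (w1 0) + σ2 0 * conj (w2 0))).re := by
  have lb : ∀ x, c * ‖lam‖ * (‖w1 x‖ ^ 2 + ‖w2 x‖ ^ 2) ≤
      (ω * ((γ * lam * w1 x + A * (2 * μ * A * w1 x - q x)) * conj (w1 x)
        + σ1 x * conj (p1 x))).re
      + (ω * ((γ * lam * w2 x - A * σ1 x) * conj (w2 x) + σ2 x * conj (p2 x))).re := by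
    intro x
    have id1 : (ω * ((γ * lam * w1 x + A * (2 * μ * A * w1 x - q x)) * conj (w1 x)
        + σ1 x * conj (p1 x))).re
      + (ω * ((γ * lam * w2 x - A * σ1 x) * conj (w2 x) + σ2 x * conj (p2 x))).re
        = γ * (ω * lam).re * (‖w1 x‖ ^ 2 + ‖w2 x‖ ^ 2)
          + μ * (‖p1 x - A * w2 x‖ ^ 2 + 2 * ‖A * w1 x‖ ^ 2 + 2 * ‖p2 x‖ ^ 2) := by
      rw [eσ2, eσ1, hdiv]
      simp only [Complex.sq_norm, Complex.normSq_apply]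
      simp [hω]
      ring
    rw [id1]
    have hV : 0 ≤ ‖w1 x‖ ^ 2 + ‖w2 x‖ ^ 2 := by positivity
    have := mul_le_mul_of_nonneg_right hlam hV
    have : 0 ≤ μ * (‖p1 x - A * w2 x‖ ^ 2 + 2 * ‖A * w1 x‖ ^ 2 + 2 * ‖p2 x‖ ^ 2) := by positivity
    linarith
  have hcl : 0 ≤ c * ‖lam‖ := by positivity
  have flux : ∀ x, 2 * (p2 x * conj (w2 x)).re ≤ 2 * (A * (‖w1 x‖ * ‖w2 x‖)) := by
    intro x
    have := Complex.re_le_norm (p2 x * conj (w2 x))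
    rw [norm_mul, Complex.norm_conj, hdiv, norm_neg, norm_mul, Complex.norm_real,
      Real.norm_of_nonneg hA.le] at this
    rw [hdiv]
    linarith
  constructor
  -- The growth of `|w2|²` is at most `2A|w1||w2| ≤ A(|w1|² + |w2|²)`, which the zeroth-order energy
  -- pays for.
  · have hd : ∀ x, HasDerivAt (fun x => A * ((ω * (σ1 x * conj (w1 x))).re
        + (ω * (σ2 x * conj (w2 x))).re) - c * ‖lam‖ * ‖w2 x‖ ^ 2) _ x := fun x =>
      (((hasDerivAt_re_mul_conj ω (dσ1 x) (dw1 x)).add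
        (hasDerivAt_re_mul_conj ω (dσ2 x) (dw2 x))).const_mul A).sub
        ((hasDerivAt_norm_sq (dw2 x)).const_mul (c * ‖lam‖))
    have key := le_of_hasDerivAt_nonneg (neg_nonpos.mpr hb.le) (fun x _ => hd x) (fun x _ => ?_)
    · simp only [hw1, hw2, map_zero, mul_zero, Complex.zero_re, norm_zero] at key
      rw [mul_add ω, Complex.add_re]
      norm_num at key
      simpa using key
    · have h1 := mul_le_mul_of_nonneg_left (lb x) hA.le
      have h2 := mul_le_mul_of_nonneg_left (flux x) hcl
      have h3 : 0 ≤ c * ‖lam‖ * A * (‖w1 x‖ - ‖w2 x‖) ^ 2 := by positivity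
      linarith
  -- Pointwise substitute for Cauchy–Schwarz applied to `w2(0) = -∫ A w1`: the weight `e^{-x/b}`
  -- supplies `-|w2|²/b`, which completes the square and leaves `b A²|w1|²`. On the layer the weight
  -- is at most `e`.
  · have hexp : ∀ x, HasDerivAt (fun x => Real.exp (-(x / b))) (Real.exp (-(x / b)) * -(1 / b)) x :=
      fun x => ((hasDerivAt_id x).div_const b).neg.exp
    have hd : ∀ x, HasDerivAt (fun x => Real.exp 1 * b * A ^ 2 * ((ω * (σ1 x * conj (w1 x))).re
        + (ω * (σ2 x * conj (w2 x))).re) - c * ‖lam‖ * (Real.exp (-(x / b)) * ‖w2 x‖ ^ 2)) _ x :=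
      fun x => (((hasDerivAt_re_mul_conj ω (dσ1 x) (dw1 x)).add
        (hasDerivAt_re_mul_conj ω (dσ2 x) (dw2 x))).const_mul (Real.exp 1 * b * A ^ 2)).sub
        (((hexp x).mul (hasDerivAt_norm_sq (dw2 x))).const_mul (c * ‖lam‖))
    have key := le_of_hasDerivAt_nonneg (neg_nonpos.mpr hb.le) (fun x _ => hd x) (fun x hx => ?_)
    · simp only [hw1, hw2, map_zero, mul_zero, Complex.zero_re, norm_zero] at key
      rw [mul_add ω, Complex.add_re]
      norm_num at key
      simpa using key
    · have hE : Real.exp (-(x / b)) ≤ Real.exp 1 := by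
        apply Real.exp_le_exp.mpr
        rw [← neg_div, div_le_iff₀ hb]
        linarith [hx.1]
      set E := Real.exp (-(x / b)) with hEdef
      have hE0 : 0 < E := Real.exp_pos _
      have h1 := mul_le_mul_of_nonneg_left (lb x) (show 0 ≤ Real.exp 1 * b * A ^ 2 by positivity)
      have h2 : E * -(1 / b) * ‖w2 x‖ ^ 2 + E * (2 * (p2 x * conj (w2 x)).re)
          ≤ Real.exp 1 * b * A ^ 2 * (‖w1 x‖ ^ 2 + ‖w2 x‖ ^ 2) := by
        calc _ = E * (2 * (p2 x * conj (w2 x)).re - 1 / b * ‖w2 x‖ ^ 2) := by ring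
          _ ≤ E * (b * A ^ 2 * ‖w1 x‖ ^ 2) := by
            have h4 : 0 ≤ b * (A * ‖w1 x‖ - 1 / b * ‖w2 x‖) ^ 2 := by positivity
            have h5 : b * (A * ‖w1 x‖ - 1 / b * ‖w2 x‖) ^ 2 = b * A ^ 2 * ‖w1 x‖ ^ 2
                - 2 * (A * (‖w1 x‖ * ‖w2 x‖)) + 1 / b * ‖w2 x‖ ^ 2 := by
              field_simp
              ring
            have := flux x
            gcongr
            linarith
          _ ≤ Real.exp 1 * (b * A ^ 2 * ‖w1 x‖ ^ 2) := by gcongr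
          _ ≤ Real.exp 1 * (b * A ^ 2 * (‖w1 x‖ ^ 2 + ‖w2 x‖ ^ 2)) := by
            gcongr
            linarith [sq_nonneg ‖w2 x‖]
          _ = _ := by ring
      have h3 := mul_le_mul_of_nonneg_left h2 hcl
      linarith

/-! ### Comparison of hyperbolic impedances -/

theorem sinh_re_le_norm_cosh (z : ℂ) : Real.sinh z.re ≤ ‖Complex.cosh z‖ := by
  have h1 : Complex.cosh z = (Complex.exp z + Complex.exp (-z)) / 2 := rfl
  have h2 := norm_sub_le_norm_add (Complex.exp z) (Complex.exp (-z))
  rw [Complex.norm_exp, Complex.norm_exp, Complex.neg_re] at h2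
  rw [h1, norm_div, Complex.norm_ofNat, Real.sinh_eq]
  linarith

theorem sinh_re_le_norm_sinh (z : ℂ) : Real.sinh z.re ≤ ‖Complex.sinh z‖ := by
  have h1 : Complex.sinh z = (Complex.exp z - Complex.exp (-z)) / 2 := rfl
  have h2 := norm_sub_norm_le (Complex.exp z) (Complex.exp (-z))
  rw [Complex.norm_exp, Complex.norm_exp, Complex.neg_re] at h2
  rw [h1, norm_div, Complex.norm_ofNat, Real.sinh_eq]
  linarith

theorem norm_cosh_le_cosh_re (z : ℂ) : ‖Complex.cosh z‖ ≤ Real.cosh z.re := by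
  have h1 : Complex.cosh z = (Complex.exp z + Complex.exp (-z)) / 2 := rfl
  have h2 := norm_add_le (Complex.exp z) (Complex.exp (-z))
  rw [Complex.norm_exp, Complex.norm_exp, Complex.neg_re] at h2
  rw [h1, norm_div, Complex.norm_ofNat, Real.cosh_eq]
  linarith

theorem norm_sinh_le_cosh_re (z : ℂ) : ‖Complex.sinh z‖ ≤ Real.cosh z.re := by
  have h1 : Complex.sinh z = (Complex.exp z - Complex.exp (-z)) / 2 := rfl
  have h2 := norm_sub_le (Complex.exp z) (Complex.exp (-z))
  rw [Complex.norm_exp, Complex.norm_exp, Complex.neg_re] at h2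
  rw [h1, norm_div, Complex.norm_ofNat, Real.cosh_eq]
  linarith

theorem sinh_div_cosh_le {x y : ℝ} (h : x ≤ y) :
    Real.sinh x / Real.cosh x ≤ Real.sinh y / Real.cosh y := by
  rw [div_le_div_iff₀ (Real.cosh_pos x) (Real.cosh_pos y)]
  have := Real.sinh_nonneg_iff.mpr (sub_nonneg.mpr h)
  rw [Real.sinh_sub] at this
  linarith

/-- Comparison of the boundary impedance of `φ'' = B² φ` with the one of `ψ'' = A² ψ`. -/
theorem impedance_comparison {A β k : ℝ} {B ω : ℂ} {φ φ' : ℝ → ℂ} {ψ ψ' R R' : ℝ → ℝ}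
    (hβ : 0 ≤ β) (hω : ω.re = 1) (hk : 0 ≤ k) (hkB : k ≤ (ω * (B ^ 2 - (A : ℂ) ^ 2)).re)
    (dφ : ∀ x, HasDerivAt φ (φ' x) x) (dφ' : ∀ x, HasDerivAt φ' (B ^ 2 * φ x) x)
    (dψ : ∀ x, HasDerivAt ψ (ψ' x) x) (dψ' : ∀ x, HasDerivAt ψ' (A ^ 2 * ψ x) x)
    (dR : ∀ x, HasDerivAt R (R' x) x) (hR : ∀ x ∈ Set.Icc 0 β, R' x ≤ ‖φ x‖ ^ 2)
    (hφ0 : φ' 0 * conj (φ 0) = 0) (hψ0 : (2 * (φ 0).re - ψ 0) * ψ' 0 = 0) (hR0 : R 0 = 0)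
    (hφβ : φ β = 1) (hψβ : ψ β = 1) :
    ψ' β + k * R β ≤ (ω * φ' β).re := by
  have dre : ∀ x, HasDerivAt (fun x => (φ x).re) ((φ' x).re) x := fun x =>
    Complex.reCLM.hasFDerivAt.comp_hasDerivAt x (dφ x)
  -- Dirichlet principle in differential form: by convexity `|φ'|² + A²|φ|²` dominates the
  -- derivative of `(2 Re φ - ψ) ψ'`, and the excess `k|φ|²` dominates `k R'`. The hypotheses at `0`
  -- cover both Neumann and Dirichlet conditions.
  have hd : ∀ x, HasDerivAt (fun x => (ω * (φ' x * conj (φ x))).re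
      - (2 * (φ x).re - ψ x) * ψ' x - k * R x) _ x := fun x =>
    ((hasDerivAt_re_mul_conj ω (dφ' x) (dφ x)).sub
      ((((dre x).const_mul 2).sub (dψ x)).mul (dψ' x))).sub ((dR x).const_mul k)
  have key := le_of_hasDerivAt_nonneg hβ (fun x _ => hd x) (fun x hx => ?_)
  · simp only [hφ0, hψ0, hR0, hφβ, hψβ, mul_zero, Complex.zero_re, map_one, mul_one,
      Complex.one_re] at key
    norm_num at key
    rw [Complex.mul_re]
    linarith
  · have h1 := mul_le_mul_of_nonneg_left (hR x hx) hk
    have h2 : k * ‖φ x‖ ^ 2 ≤ (ω * (B ^ 2 - (A : ℂ) ^ 2)).re * ‖φ x‖ ^ 2 := by gcongr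
    have h3 : (ω * (B ^ 2 * φ x * conj (φ x) + φ' x * conj (φ' x))).re
        = (ω * (B ^ 2 - (A : ℂ) ^ 2)).re * ‖φ x‖ ^ 2 + A ^ 2 * ‖φ x‖ ^ 2 + ‖φ' x‖ ^ 2 := by
      simp only [Complex.sq_norm, Complex.normSq_apply]
      simp [hω, pow_two]
      ring
    have h4 : (φ x).re ^ 2 ≤ ‖φ x‖ ^ 2 := by
      rw [Complex.sq_norm, Complex.normSq_apply]; nlinarith [sq_nonneg (φ x).im]
    have h5 : (φ' x).re ^ 2 ≤ ‖φ' x‖ ^ 2 := by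
      rw [Complex.sq_norm, Complex.normSq_apply]; nlinarith [sq_nonneg (φ' x).im]
    have h6 : A ^ 2 * (φ x).re ^ 2 ≤ A ^ 2 * ‖φ x‖ ^ 2 := by gcongr
    have h7 : 0 ≤ A ^ 2 * ((φ x).re - ψ x) ^ 2 := by positivity
    rw [h3]
    simp only [Pi.sub_apply]
    nlinarith [sq_nonneg ((φ' x).re - ψ' x)]

theorem hasDerivAt_cexp_mul (B : ℂ) (x : ℝ) :
    HasDerivAt (fun x : ℝ => Complex.exp (B * x)) (B * Complex.exp (B * x)) x := by
  have h := ((hasDerivAt_id x).ofReal_comp.const_mul B).cexp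
  simp only [id, Complex.ofReal_one, mul_one] at h
  rw [mul_comm B (Complex.exp _)]
  exact h

theorem hasDerivAt_ccosh_mul (B : ℂ) (x : ℝ) :
    HasDerivAt (fun x : ℝ => Complex.cosh (B * x)) (B * Complex.sinh (B * x)) x := by
  have h := ((hasDerivAt_id (x : ℂ)).const_mul B).ccosh.comp_ofReal
  simp only [id, mul_one] at h
  rw [mul_comm B (Complex.sinh _)]
  exact h

theorem hasDerivAt_csinh_mul (B : ℂ) (x : ℝ) :
    HasDerivAt (fun x : ℝ => Complex.sinh (B * x)) (B * Complex.cosh (B * x)) x := by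
  have h := ((hasDerivAt_id (x : ℂ)).const_mul B).csinh.comp_ofReal
  simp only [id, mul_one] at h
  rw [mul_comm B (Complex.cosh _)]
  exact h

theorem hasDerivAt_cosh_mul (A x : ℝ) :
    HasDerivAt (fun x : ℝ => Real.cosh (A * x)) (A * Real.sinh (A * x)) x := by
  have h := ((hasDerivAt_id x).const_mul A).cosh
  simp only [id, mul_one] at h
  rw [mul_comm A (Real.sinh _)]
  exact h

theorem hasDerivAt_sinh_mul (A x : ℝ) :
    HasDerivAt (fun x : ℝ => Real.sinh (A * x)) (A * Real.cosh (A * x)) x := by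
  have h := ((hasDerivAt_id x).const_mul A).sinh
  simp only [id, mul_one] at h
  rw [mul_comm A (Real.cosh _)]
  exact h

/-- `sinh³ / (3 s cosh)` has derivative at most `sinh²`. -/
theorem hasDerivAt_sinh_cube_div_cosh {s : ℝ} (hs : 0 < s) (x : ℝ) :
    HasDerivAt (fun x : ℝ => Real.sinh (s * x) ^ 3 / (3 * s * Real.cosh (s * x)))
      (Real.sinh (s * x) ^ 2 - Real.sinh (s * x) ^ 4 / (3 * Real.cosh (s * x) ^ 2)) x := by
  have hc : Real.cosh (s * x) ≠ 0 := (Real.cosh_pos _).ne'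
  have h := ((hasDerivAt_sinh_mul s x).pow 3).div ((hasDerivAt_cosh_mul s x).const_mul (3 * s))
    (by positivity)
  refine h.congr_deriv ?_
  simp only [Pi.pow_apply]
  field_simp
  push_cast
  ring

/-- The mass term is `tanh³(sβ)/(3s)`. Since `|B² - A²| = |B - A| |B + A|` and `|B + A| ≥ s`, the
factor `1/s` cancels and the bound is uniform in `s`. -/
theorem norm_sub_impedance_ge {s β A c : ℝ} {B ω Z : ℂ} {z : ℝ} {T : ℝ}
    (hs : s = B.re) (hs0 : 0 < s) (hA : 0 < A) (hc : 0 ≤ c) (hT : 0 ≤ T)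
    (hTs : T ≤ Real.sinh (s * β) / Real.cosh (s * β)) (hω : ω.re = 1)
    (h : z + c * ‖B ^ 2 - (A : ℂ) ^ 2‖ *
        (Real.sinh (s * β) ^ 3 / (3 * s * Real.cosh (s * β)) / Real.cosh (s * β) ^ 2)
        ≤ (ω * Z).re) :
    c * (T ^ 3 / 3) * ‖B - A‖ ≤ ‖ω‖ * ‖Z - z‖ := by
  have hch : 0 < Real.cosh (s * β) := Real.cosh_pos _
  have h1 : (ω * (Z - z)).re ≤ ‖ω‖ * ‖Z - z‖ := by
    rw [← norm_mul]; exact Complex.re_le_norm _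
  have h2 : (ω * (Z - z)).re = (ω * Z).re - z := by
    rw [mul_sub, Complex.sub_re, Complex.re_mul_ofReal, hω, one_mul]
  have h3 : Real.sinh (s * β) ^ 3 / (3 * s * Real.cosh (s * β)) / Real.cosh (s * β) ^ 2
      = (Real.sinh (s * β) / Real.cosh (s * β)) ^ 3 / 3 * (1 / s) := by
    field_simp
  have h4 : T ^ 3 ≤ (Real.sinh (s * β) / Real.cosh (s * β)) ^ 3 := by gcongr
  have h5 : s ≤ ‖B + A‖ := by
    have := Complex.re_le_norm (B + A)
    rw [Complex.add_re, Complex.ofReal_re, ← hs] at this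
    linarith
  have h6 : B ^ 2 - (A : ℂ) ^ 2 = (B - A) * (B + A) := by ring
  rw [h3, h6, norm_mul] at h
  calc c * (T ^ 3 / 3) * ‖B - A‖ = c * (‖B - A‖ * s) * (T ^ 3 / 3 * (1 / s)) := by field_simp
    _ ≤ c * (‖B - A‖ * ‖B + A‖) *
        ((Real.sinh (s * β) / Real.cosh (s * β)) ^ 3 / 3 * (1 / s)) := by gcongr
    _ ≤ _ := by linarith

section
variable {s0 β A c : ℝ} {B ω : ℂ}

/-- Neumann condition at `0`, that is, modes even about mid-layer. The primitive `R` stands in for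
`∫|φ|²`, through `|cosh(Bx)| ≥ sinh(sx)` and `|cosh(Bβ)| ≤ cosh(sβ)`. -/
theorem norm_sub_tanh_ge (hβ : 0 < β) (hs0 : 0 < s0) (hsB : s0 ≤ B.re) (hA : 0 < A) (hc : 0 ≤ c)
    (hω : ω.re = 1) (hB : c * ‖B ^ 2 - (A : ℂ) ^ 2‖ ≤ (ω * (B ^ 2 - (A : ℂ) ^ 2)).re) :
    c * ((Real.sinh (s0 * β) / Real.cosh (s0 * β)) ^ 3 / 3) * ‖B - A‖ ≤
      ‖ω‖ * ‖B * Complex.sinh (B * β) / Complex.cosh (B * β)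
        - (A * Real.sinh (A * β) / Real.cosh (A * β) : ℝ)‖ := by
  set s := B.re with hs
  have hspos : 0 < s := hs0.trans_le hsB
  have hre : ∀ x : ℝ, (B * x).re = s * x := fun x => Complex.re_mul_ofReal B x
  have hsh : 0 < Real.sinh (s * β) := Real.sinh_pos_iff.mpr (by positivity)
  have hcn : 0 < ‖Complex.cosh (B * β)‖ := by
    have := sinh_re_le_norm_cosh (B * β)
    rw [hre] at this
    linarith
  have hc0 : Complex.cosh (B * β) ≠ 0 := norm_pos_iff.mp hcn
  have hch : 0 < Real.cosh (s * β) := Real.cosh_pos _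
  have hcA : Real.cosh (A * β) ≠ 0 := (Real.cosh_pos _).ne'
  refine norm_sub_impedance_ge hs hspos hA hc (div_nonneg (Real.sinh_nonneg_iff.mpr (by positivity))
    (Real.cosh_pos _).le) (sinh_div_cosh_le (by gcongr)) hω ?_
  refine impedance_comparison (φ := fun x => Complex.cosh (B * x) / Complex.cosh (B * β))
    (φ' := fun x => B * Complex.sinh (B * x) / Complex.cosh (B * β))
    (ψ := fun x => Real.cosh (A * x) / Real.cosh (A * β))
    (ψ' := fun x => A * Real.sinh (A * x) / Real.cosh (A * β))
    (R := fun x => Real.sinh (s * x) ^ 3 / (3 * s * Real.cosh (s * x)) / Real.cosh (s * β) ^ 2)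
    hβ.le hω (by positivity) hB
    (fun x => (hasDerivAt_ccosh_mul B x).div_const _)
    (fun x => ?_)
    (fun x => (hasDerivAt_cosh_mul A x).div_const _)
    (fun x => ?_)
    (fun x => (hasDerivAt_sinh_cube_div_cosh hspos x).div_const _)
    (fun x hx => ?_) (by simp) (by simp) (by simp) (div_self hc0) (div_self hcA)
  · refine (((hasDerivAt_csinh_mul B x).const_mul B).div_const (Complex.cosh (B * β))).congr_deriv ?_
    ring
  · refine (((hasDerivAt_sinh_mul A x).const_mul A).div_const (Real.cosh (A * β))).congr_deriv ?_
    ring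
  · have h1 := sinh_re_le_norm_cosh (B * x)
    have h2 := norm_cosh_le_cosh_re (B * β)
    rw [hre] at h1 h2
    have h3 : 0 ≤ Real.sinh (s * x) := Real.sinh_nonneg_iff.mpr (mul_nonneg hspos.le hx.1)
    rw [norm_div, div_pow]
    have h4 : 0 ≤ Real.sinh (s * x) ^ 4 / (3 * Real.cosh (s * x) ^ 2) := by positivity
    calc _ ≤ Real.sinh (s * x) ^ 2 / Real.cosh (s * β) ^ 2 := by gcongr; linarith
      _ ≤ _ := by gcongr

/-- Dirichlet condition at `0`, that is, odd modes; the same `R` serves. -/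
theorem norm_sub_coth_ge (hβ : 0 < β) (hs0 : 0 < s0) (hsB : s0 ≤ B.re) (hA : 0 < A) (hc : 0 ≤ c)
    (hω : ω.re = 1) (hB : c * ‖B ^ 2 - (A : ℂ) ^ 2‖ ≤ (ω * (B ^ 2 - (A : ℂ) ^ 2)).re) :
    c * ((Real.sinh (s0 * β) / Real.cosh (s0 * β)) ^ 3 / 3) * ‖B - A‖ ≤
      ‖ω‖ * ‖B * Complex.cosh (B * β) / Complex.sinh (B * β)
        - (A * Real.cosh (A * β) / Real.sinh (A * β) : ℝ)‖ := by
  set s := B.re with hs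
  have hspos : 0 < s := hs0.trans_le hsB
  have hre : ∀ x : ℝ, (B * x).re = s * x := fun x => Complex.re_mul_ofReal B x
  have hsh : 0 < Real.sinh (s * β) := Real.sinh_pos_iff.mpr (by positivity)
  have hcn : 0 < ‖Complex.sinh (B * β)‖ := by
    have := sinh_re_le_norm_sinh (B * β)
    rw [hre] at this
    linarith
  have hc0 : Complex.sinh (B * β) ≠ 0 := norm_pos_iff.mp hcn
  have hch : 0 < Real.cosh (s * β) := Real.cosh_pos _
  have hcA : Real.sinh (A * β) ≠ 0 := (Real.sinh_pos_iff.mpr (by positivity)).ne'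
  refine norm_sub_impedance_ge hs hspos hA hc (div_nonneg (Real.sinh_nonneg_iff.mpr (by positivity))
    (Real.cosh_pos _).le) (sinh_div_cosh_le (by gcongr)) hω ?_
  refine impedance_comparison (φ := fun x => Complex.sinh (B * x) / Complex.sinh (B * β))
    (φ' := fun x => B * Complex.cosh (B * x) / Complex.sinh (B * β))
    (ψ := fun x => Real.sinh (A * x) / Real.sinh (A * β))
    (ψ' := fun x => A * Real.cosh (A * x) / Real.sinh (A * β))
    (R := fun x => Real.sinh (s * x) ^ 3 / (3 * s * Real.cosh (s * x)) / Real.cosh (s * β) ^ 2)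
    hβ.le hω (by positivity) hB
    (fun x => (hasDerivAt_csinh_mul B x).div_const _)
    (fun x => ?_)
    (fun x => (hasDerivAt_sinh_mul A x).div_const _)
    (fun x => ?_)
    (fun x => (hasDerivAt_sinh_cube_div_cosh hspos x).div_const _)
    (fun x hx => ?_) (by simp) (by simp) (by simp) (div_self hc0) (div_self hcA)
  · refine (((hasDerivAt_ccosh_mul B x).const_mul B).div_const (Complex.sinh (B * β))).congr_deriv ?_
    ring
  · refine (((hasDerivAt_cosh_mul A x).const_mul A).div_const (Real.sinh (A * β))).congr_deriv ?_
    ring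
  · have h1 := sinh_re_le_norm_sinh (B * x)
    have h2 := norm_sinh_le_cosh_re (B * β)
    rw [hre] at h1 h2
    have h3 : 0 ≤ Real.sinh (s * x) := Real.sinh_nonneg_iff.mpr (mul_nonneg hspos.le hx.1)
    rw [norm_div, div_pow]
    have h4 : 0 ≤ Real.sinh (s * x) ^ 4 / (3 * Real.cosh (s * x) ^ 2) := by positivity
    calc _ ≤ Real.sinh (s * x) ^ 2 / Real.cosh (s * β) ^ 2 := by gcongr; linarith
      _ ≤ _ := by gcongr

end

/-! ### The trace determinant of the layer -/

/-- Lower bound for the determinant `(1 - e a)² - (A + B)² M²` that relates the parameters of the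
layer solution to its trace, where `e = e^{-B b}`, `a = e^{-A b}` and `M = (e - a) / (B - A)`. -/
theorem norm_trace_det_ge {s0 b A c K : ℝ} {B ω : ℂ} (hb : 0 < b) (hs0 : 0 < s0)
    (hsB : s0 ≤ B.re) (hA : 0 < A) (hc : 0 ≤ c) (hω : ω.re = 1) (hK : ‖ω‖ ≤ K) (hBA : B ≠ A)
    (hB : c * ‖B ^ 2 - (A : ℂ) ^ 2‖ ≤ (ω * (B ^ 2 - (A : ℂ) ^ 2)).re) :
    (1 - Real.exp (-(s0 * b))) ^ 2
        * (c * ((Real.sinh (s0 * (b / 2)) / Real.cosh (s0 * (b / 2))) ^ 3 / 3)) ^ 2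
        * (1 - Real.exp (-(A * b)))
      ≤ K ^ 2 * ‖(1 - Complex.exp (-(B * b)) * Complex.exp (-(A * b))) ^ 2 - (A + B) ^ 2
        * ((Complex.exp (-(B * b)) - Complex.exp (-(A * b))) / (B - A)) ^ 2‖ := by
  set κ := c * ((Real.sinh (s0 * (b / 2)) / Real.cosh (s0 * (b / 2))) ^ 3 / 3) with hκ
  have hκ0 : 0 ≤ κ := by
    have : 0 ≤ Real.sinh (s0 * (b / 2)) := Real.sinh_nonneg_iff.mpr (by positivity)
    have := (Real.cosh_pos (s0 * (b / 2))).le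
    positivity
  have h1 := norm_sub_tanh_ge (half_pos hb) hs0 hsB hA hc hω hB
  have h2 := norm_sub_coth_ge (half_pos hb) hs0 hsB hA hc hω hB
  set Z := B * Complex.sinh (B * (b / 2 : ℝ)) / Complex.cosh (B * (b / 2 : ℝ))
    - (A * Real.sinh (A * (b / 2)) / Real.cosh (A * (b / 2)) : ℝ) with hZ
  set W := B * Complex.cosh (B * (b / 2 : ℝ)) / Complex.sinh (B * (b / 2 : ℝ))
    - (A * Real.cosh (A * (b / 2)) / Real.sinh (A * (b / 2)) : ℝ) with hW
  set e := Complex.exp (-(B * b)) with he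
  set a := Complex.exp (-(A * b)) with ha
  have ha' : a = (Real.exp (-(A * b)) : ℝ) := by rw [ha]; push_cast; rfl
  have hee : ‖e‖ ≤ Real.exp (-(s0 * b)) := by
    rw [he, Complex.norm_exp]
    apply Real.exp_le_exp.mpr
    rw [Complex.neg_re, Complex.re_mul_ofReal]
    have : s0 * b ≤ B.re * b := by gcongr
    linarith
  have hq0 : Real.exp (-(s0 * b)) < 1 := by
    rw [Real.exp_lt_one_iff]
    have := mul_pos hs0 hb
    linarith
  have ha1 : Real.exp (-(A * b)) < 1 := by
    rw [Real.exp_lt_one_iff]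
    have := mul_pos hA hb
    linarith
  have ha0 := Real.exp_pos (-(A * b))
  have n1 : 1 - Real.exp (-(s0 * b)) ≤ ‖1 - e‖ := by
    have := norm_sub_norm_le (1 : ℂ) e
    rw [norm_one] at this
    linarith
  have n2 : 1 - Real.exp (-(s0 * b)) ≤ ‖1 + e‖ := by
    have := norm_sub_le_norm_add (1 : ℂ) e
    rw [norm_one] at this
    linarith
  have n3 : ‖1 - a‖ = 1 - Real.exp (-(A * b)) := by
    rw [ha', ← Complex.ofReal_one, ← Complex.ofReal_sub, Complex.norm_real,
      Real.norm_of_nonneg (by linarith)]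
  have n4 : 1 ≤ ‖1 + a‖ := by
    rw [ha', ← Complex.ofReal_one, ← Complex.ofReal_add, Complex.norm_real,
      Real.norm_of_nonneg (by linarith)]
    linarith
  have hC : ∀ z : ℂ, 1 + Complex.exp (-(z * b))
      = 2 * Complex.exp (-(z * (b / 2 : ℝ))) * Complex.cosh (z * (b / 2 : ℝ)) := by
    intro z
    have : Complex.cosh (z * (b / 2 : ℝ))
      = (Complex.exp (z * (b / 2 : ℝ)) + Complex.exp (-(z * (b / 2 : ℝ)))) / 2 := rfl
    rw [this, mul_div_assoc', eq_div_iff two_ne_zero, mul_assoc 2, mul_add, ← Complex.exp_add,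
      ← Complex.exp_add, neg_add_cancel, Complex.exp_zero]
    have : -(z * (b / 2 : ℝ)) + -(z * (b / 2 : ℝ)) = -(z * b) := by push_cast; ring
    rw [this]; ring
  have hS : ∀ z : ℂ, 1 - Complex.exp (-(z * b))
      = 2 * Complex.exp (-(z * (b / 2 : ℝ))) * Complex.sinh (z * (b / 2 : ℝ)) := by
    intro z
    have : Complex.sinh (z * (b / 2 : ℝ))
      = (Complex.exp (z * (b / 2 : ℝ)) - Complex.exp (-(z * (b / 2 : ℝ)))) / 2 := rfl
    rw [this, mul_div_assoc', eq_div_iff two_ne_zero, mul_assoc 2, mul_sub, ← Complex.exp_add,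
      ← Complex.exp_add, neg_add_cancel, Complex.exp_zero]
    have : -(z * (b / 2 : ℝ)) + -(z * (b / 2 : ℝ)) = -(z * b) := by push_cast; ring
    rw [this]; ring
  have x1 := hC B
  have x2 := hS B
  have x3 := hC A
  have x4 := hS A
  rw [← he] at x1 x2
  rw [← ha] at x3 x4
  have ne1 : (1 + e) ≠ 0 := norm_pos_iff.mp (by linarith)
  have ne2 : (1 - e) ≠ 0 := norm_pos_iff.mp (by linarith)
  have ne3 : (1 + a) ≠ 0 := norm_pos_iff.mp (by linarith)
  have ne4 : (1 - a) ≠ 0 := norm_pos_iff.mp (by linarith)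
  have r1 : Complex.sinh (B * (b / 2 : ℝ)) / Complex.cosh (B * (b / 2 : ℝ)) = (1 - e) / (1 + e) := by
    rw [x1, x2, mul_div_mul_left]
    exact mul_ne_zero two_ne_zero (Complex.exp_ne_zero _)
  have r2 : Complex.sinh (A * (b / 2 : ℝ)) / Complex.cosh (A * (b / 2 : ℝ)) = (1 - a) / (1 + a) := by
    rw [x3, x4, mul_div_mul_left]
    exact mul_ne_zero two_ne_zero (Complex.exp_ne_zero _)
  have r3 : Complex.cosh (B * (b / 2 : ℝ)) / Complex.sinh (B * (b / 2 : ℝ)) = (1 + e) / (1 - e) := by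
    rw [x1, x2, mul_div_mul_left]
    exact mul_ne_zero two_ne_zero (Complex.exp_ne_zero _)
  have r4 : Complex.cosh (A * (b / 2 : ℝ)) / Complex.sinh (A * (b / 2 : ℝ)) = (1 + a) / (1 - a) := by
    rw [x3, x4, mul_div_mul_left]
    exact mul_ne_zero two_ne_zero (Complex.exp_ne_zero _)
  have hZ' : Z = B * ((1 - e) / (1 + e)) - A * ((1 - a) / (1 + a)) := by
    rw [hZ, mul_div_assoc, r1, ← r2, Complex.ofReal_div, Complex.ofReal_mul, Complex.ofReal_sinh,
      Complex.ofReal_cosh, Complex.ofReal_mul, mul_div_assoc]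
  have hW' : W = B * ((1 + e) / (1 - e)) - A * ((1 + a) / (1 - a)) := by
    rw [hW, mul_div_assoc, r3, ← r4, Complex.ofReal_div, Complex.ofReal_mul, Complex.ofReal_sinh,
      Complex.ofReal_cosh, Complex.ofReal_mul, mul_div_assoc]
  have hBA' : B - A ≠ 0 := sub_ne_zero.mpr hBA
  -- The difference of squares factors into the two impedance gaps `Z` and `W`, each of size at
  -- least a multiple of `|B - A|`; this cancels the denominator. Of the remaining factors only `1 -
  -- a` is small as `A → 0`.
  have hdet : (1 - e * a) ^ 2 - (A + B) ^ 2 * ((e - a) / (B - A)) ^ 2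
      = (1 + e) * (1 - e) * ((1 + a) * (1 - a)) * (Z * W) / (B - A) ^ 2 := by
    rw [hZ', hW']
    field_simp
    ring
  rw [hdet, norm_div, norm_mul, norm_mul, norm_mul, norm_mul, norm_mul, norm_pow, n3]
  have hnBA : 0 < ‖B - A‖ := norm_pos_iff.mpr hBA'
  have h1' : κ * ‖B - A‖ ≤ K * ‖Z‖ := h1.trans (by gcongr)
  have h2' : κ * ‖B - A‖ ≤ K * ‖W‖ := h2.trans (by gcongr)
  rw [mul_div_assoc', le_div_iff₀ (by positivity)]
  calc (1 - Real.exp (-(s0 * b))) ^ 2 * κ ^ 2 * (1 - Real.exp (-(A * b))) * ‖B - A‖ ^ 2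
      = (1 - Real.exp (-(s0 * b))) * (1 - Real.exp (-(s0 * b)))
        * (1 * (1 - Real.exp (-(A * b)))) * ((κ * ‖B - A‖) * (κ * ‖B - A‖)) := by ring
    _ ≤ ‖1 + e‖ * ‖1 - e‖ * (‖1 + a‖ * (1 - Real.exp (-(A * b))))
        * ((K * ‖Z‖) * (K * ‖W‖)) := by
      have : 0 ≤ 1 - Real.exp (-(s0 * b)) := by linarith
      have : 0 ≤ 1 - Real.exp (-(A * b)) := by linarith
      have : 0 ≤ K * ‖Z‖ := le_trans (by positivity) h1'
      gcongr
    _ = _ := by ring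

/-! ### Explicit solutions and their coercivity -/

theorem tendsto_cexp_neg_mul_atTop {α : ℂ} (hα : 0 < α.re) :
    Tendsto (fun x : ℝ => Complex.exp (-α * x)) atTop (𝓝 0) := by
  rw [tendsto_zero_iff_norm_tendsto_zero]
  have h : ∀ x : ℝ, ‖Complex.exp (-α * x)‖ = Real.exp (-(α.re * x)) := by
    intro x
    rw [Complex.norm_exp, Complex.re_mul_ofReal, Complex.neg_re, neg_mul]
  simp only [h]
  exact Real.tendsto_exp_neg_atTop_nhds_zero.comp (tendsto_id.const_mul_atTop hα)

/-- Coercivity of the Dirichlet-to-Neumann matrix of the half-line Lamé system. -/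
theorem halfLine_coercive {A μ γ c : ℝ} {lam κ ω α β D : ℂ}
    (hA : 0 < A) (hc : 0 < c) (hω : ω.re = 1) (hμ : c ≤ μ)
    (hlam : c * ‖lam‖ ≤ γ * (ω * lam).re) (hκ : c ≤ (ω * κ).re)
    (hα : 0 < α.re) (hβ : 0 < β.re) (hD : D = α * β - A ^ 2) (hD0 : D ≠ 0)
    (eα : (γ : ℂ) * lam = (μ + κ) * (α ^ 2 - A ^ 2))
    (eβ : (γ : ℂ) * lam = μ * (β ^ 2 - A ^ 2)) (g1 g2 : ℂ) :
    c / 4 * (√‖lam‖ + A) * (‖g1‖ ^ 2 + ‖g2‖ ^ 2) ≤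
      -(ω * ((-μ * (α * (β ^ 2 - A ^ 2) / D) * g1
            + -μ * (A * (2 * α * β - A ^ 2 - β ^ 2) / D) * g2) * conj g1
          + (-A * (2 * μ * (α * (β - α) / D) - (κ - μ) * ((α ^ 2 - A ^ 2) / D)) * g1
            + -(μ + κ) * (β * (α ^ 2 - A ^ 2) / D) * g2) * conj g2)).re := by
  -- `C` and `d` are the amplitudes of the gradient wave `e^{-αx}` and the solenoidal wave
  -- `e^{-βx}`, solved from the boundary value `(g1, g2)`; the determinant of that system is `D`.
  set C := (A * g1 - β * g2) / D with hC
  set d := (α * g1 - A * g2) / D with hd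
  have dE : ∀ (z : ℂ) (x : ℝ), HasDerivAt (fun x : ℝ => Complex.exp (-z * x))
    (-z * Complex.exp (-z * x)) x := fun z x => hasDerivAt_cexp_mul (-z) x
  have comb : ∀ (u w : ℂ) (x : ℝ), HasDerivAt
      (fun x : ℝ => u * Complex.exp (-α * x) + w * Complex.exp (-β * x))
      (u * (-α * Complex.exp (-α * x)) + w * (-β * Complex.exp (-β * x))) x := fun u w x =>
    ((dE α x).const_mul u).add ((dE β x).const_mul w)
  have tcomb : ∀ (u w : ℂ), Tendsto
      (fun x : ℝ => u * Complex.exp (-α * x) + w * Complex.exp (-β * x)) atTop (𝓝 0) := by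
    intro u w
    have := ((tendsto_cexp_neg_mul_atTop hα).const_mul u).add
      ((tendsto_cexp_neg_mul_atTop hβ).const_mul w)
    rwa [mul_zero, mul_zero, add_zero] at this
  have key := halfLine_energy (A := A) (μ := μ) (γ := γ) (c := c) (lam := lam) (κ := κ) (ω := ω)
    (v1 := fun x : ℝ => -(A * C) * Complex.exp (-α * x) + β * d * Complex.exp (-β * x))
    (v2 := fun x : ℝ => -(α * C) * Complex.exp (-α * x) + A * d * Complex.exp (-β * x))
    (p1 := fun x : ℝ => A * α * C * Complex.exp (-α * x) + -(β ^ 2 * d) * Complex.exp (-β * x))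
    (p2 := fun x : ℝ => α ^ 2 * C * Complex.exp (-α * x) + -(A * β * d) * Complex.exp (-β * x))
    (τ1 := fun x : ℝ => 2 * μ * A * α * C * Complex.exp (-α * x)
      + -(μ * (β ^ 2 + A ^ 2) * d) * Complex.exp (-β * x))
    (τ2 := fun x : ℝ => (2 * μ * α ^ 2 + (κ - μ) * (α ^ 2 - A ^ 2)) * C * Complex.exp (-α * x)
      + -(2 * μ * A * β * d) * Complex.exp (-β * x))
    hA hc hω hμ hlam hκ
    (fun x => (comb _ _ x).congr_deriv (by ring))
    (fun x => (comb _ _ x).congr_deriv (by ring))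
    (fun x => by ring) (fun x => by ring)
    (fun x => (comb _ _ x).congr_deriv (by
      linear_combination (A * C * Complex.exp (-α * x)) * eα
        - (β * d * Complex.exp (-β * x)) * eβ))
    (fun x => (comb _ _ x).congr_deriv (by
      linear_combination (α * C * Complex.exp (-α * x)) * eα
        - (A * d * Complex.exp (-β * x)) * eβ))
    (tcomb _ _) (tcomb _ _) (tcomb _ _) (tcomb _ _)
  simp only [Complex.ofReal_zero, mul_zero, Complex.exp_zero, mul_one] at key
  have r1 : -(A * C) + β * d = g1 := by
    rw [hC, hd]; field_simp; rw [hD]; ring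
  have r2 : -(α * C) + A * d = g2 := by
    rw [hC, hd]; field_simp; rw [hD]; ring
  have r3 : 2 * μ * A * α * C + -(μ * (β ^ 2 + A ^ 2) * d)
      = -μ * (α * (β ^ 2 - A ^ 2) / D) * g1
        + -μ * (A * (2 * α * β - A ^ 2 - β ^ 2) / D) * g2 := by
    rw [hC, hd]; field_simp; ring
  have r4 : (2 * μ * α ^ 2 + (κ - μ) * (α ^ 2 - A ^ 2)) * C + -(2 * μ * A * β * d)
      = -A * (2 * μ * (α * (β - α) / D) - (κ - μ) * ((α ^ 2 - A ^ 2) / D)) * g1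
        + -(μ + κ) * (β * (α ^ 2 - A ^ 2) / D) * g2 := by
    rw [hC, hd]; field_simp; ring
  rw [r1, r2, r3, r4] at key
  exact key

/-- Energy of the explicit Stokes solution in the layer: `h` parametrizes the waves decaying from
the interface, `k` the waves reflected at the bottom. -/
theorem layer_coercive {A μ γ c b : ℝ} {lam ω B e a M h1 h2 k1 k2 g1 g2 s1 s2 : ℂ}
    (hA : 0 < A) (hb : 0 < b) (hc : 0 < c) (hω : ω.re = 1) (hμ : 0 ≤ μ)
    (hlam : c * ‖lam‖ ≤ γ * (ω * lam).re) (hBA : B ≠ A)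
    (eB : (γ : ℂ) * lam = μ * (B ^ 2 - A ^ 2))
    (he : e = Complex.exp (-(B * b))) (ha : a = Complex.exp (-(A * b)))
    (hM : M = (e - a) / (B - A))
    (hk1 : k1 = -(h1 * e + A * (h1 + B * h2) * M)) (hk2 : k2 = -(h2 * e - (h1 + B * h2) * M))
    (hg1 : g1 = h1 + k1 * e + A * (k1 - B * k2) * M)
    (hg2 : g2 = A * (h2 + k2 * e + (k1 - B * k2) * M))
    (hs1 : s1 = -μ * (A + B) * h1 + -μ * (B - A) * A * h2
      + (μ * ((A + B) * e + 2 * A ^ 2 * M)) * k1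
      + (-μ * (2 * A ^ 2 * B * M + (B - A) * A * e)) * k2)
    (hs2 : s2 = -μ * (B - A) * h1 + -μ * (A + B) * B * h2
      + (2 * μ * A * B * M - μ * (B - A) * a) * k1
      + (-2 * μ * A ^ 2 * B * M + μ * (B + A) * B * a) * k2) :
    c * ‖lam‖ * ‖g2‖ ^ 2 ≤ A * -(ω * (s1 * conj g1 + s2 * conj g2)).re ∧
    c * ‖lam‖ * ‖g2‖ ^ 2 ≤ Real.exp 1 * b * A ^ 2 * -(ω * (s1 * conj g1 + s2 * conj g2)).re := by
  have hBA' : B - A ≠ 0 := sub_ne_zero.mpr hBA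
  -- The wave from the interface has velocity `(h1, A h2)` at `0`, the reflected wave has velocity
  -- `(k1, A k2)` at `-b`. The formulas for `k1`, `k2` say that the two cancel at the bottom.
  set c1 := -(h1 + A * h2) / (B - A) with hc1
  set c2 := (h1 + B * h2) / (B - A) with hc2
  set d1 := (k1 - A * k2) / (B - A) with hd1
  set d2 := (B * k2 - k1) / (B - A) with hd2
  have dE : ∀ (z : ℂ) (x : ℝ), HasDerivAt (fun x : ℝ => Complex.exp (z * x))
    (z * Complex.exp (z * x)) x := hasDerivAt_cexp_mul
  have comb : ∀ (u1 u2 u3 u4 : ℂ) (x : ℝ), HasDerivAt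
      (fun x : ℝ => u1 * Complex.exp (B * x) + u2 * Complex.exp (A * x)
        + u3 * Complex.exp (-B * x) + u4 * Complex.exp (-A * x))
      (u1 * (B * Complex.exp (B * x)) + u2 * (A * Complex.exp (A * x))
        + u3 * (-B * Complex.exp (-B * x)) + u4 * (-A * Complex.exp (-A * x))) x :=
    fun u1 u2 u3 u4 x => ((((dE _ x).const_mul u1).add ((dE _ x).const_mul u2)).add
      ((dE _ x).const_mul u3)).add ((dE _ x).const_mul u4)
  have heb : e * Complex.exp (B * b) = 1 := by
    rw [he, ← Complex.exp_add, neg_add_cancel, Complex.exp_zero]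
  have hab : a * Complex.exp (A * b) = 1 := by
    rw [ha, ← Complex.exp_add, neg_add_cancel, Complex.exp_zero]
  have x1 : Complex.exp (B * (-b : ℝ)) = e := by rw [he]; congr 1; push_cast; ring
  have x2 : Complex.exp (A * (-b : ℝ)) = a := by rw [ha]; congr 1; push_cast; ring
  have x3 : Complex.exp (-B * (-b : ℝ)) = Complex.exp (B * b) := by congr 1; push_cast; ring
  have x4 : Complex.exp (-A * (-b : ℝ)) = Complex.exp (A * b) := by congr 1; push_cast; ring
  have key := layer_energy (A := A) (μ := μ) (γ := γ) (c := c) (b := b) (lam := lam) (ω := ω)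
    (w1 := fun x : ℝ => -(B * c1) * Complex.exp (B * x) + -(A * c2) * Complex.exp (A * x)
      + B * d1 * e * Complex.exp (-B * x) + A * d2 * a * Complex.exp (-A * x))
    (w2 := fun x : ℝ => A * c1 * Complex.exp (B * x) + A * c2 * Complex.exp (A * x)
      + A * d1 * e * Complex.exp (-B * x) + A * d2 * a * Complex.exp (-A * x))
    (p1 := fun x : ℝ => -(B ^ 2 * c1) * Complex.exp (B * x) + -(A ^ 2 * c2) * Complex.exp (A * x)
      + -(B ^ 2 * d1 * e) * Complex.exp (-B * x) + -(A ^ 2 * d2 * a) * Complex.exp (-A * x))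
    (p2 := fun x : ℝ => A * B * c1 * Complex.exp (B * x) + A ^ 2 * c2 * Complex.exp (A * x)
      + -(A * B * d1 * e) * Complex.exp (-B * x) + -(A ^ 2 * d2 * a) * Complex.exp (-A * x))
    (q := fun x : ℝ => γ * lam * (-c2 * Complex.exp (A * x) + d2 * a * Complex.exp (-A * x)))
    (σ1 := fun x : ℝ => -(μ * (A ^ 2 + B ^ 2) * c1) * Complex.exp (B * x)
      + -(2 * μ * A ^ 2 * c2) * Complex.exp (A * x)
      + -(μ * (A ^ 2 + B ^ 2) * d1 * e) * Complex.exp (-B * x)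
      + -(2 * μ * A ^ 2 * d2 * a) * Complex.exp (-A * x))
    (σ2 := fun x : ℝ => 2 * μ * A * B * c1 * Complex.exp (B * x)
      + (2 * μ * A ^ 2 + γ * lam) * c2 * Complex.exp (A * x)
      + -(2 * μ * A * B * d1 * e) * Complex.exp (-B * x)
      + -((2 * μ * A ^ 2 + γ * lam) * d2 * a) * Complex.exp (-A * x))
    hA hb hc hω hμ hlam
    (fun x => (comb _ _ _ _ x).congr_deriv (by ring))
    (fun x => (comb _ _ _ _ x).congr_deriv (by ring))
    (fun x => by ring) (fun x => by ring) (fun x => by ring)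
    (fun x => (comb _ _ _ _ x).congr_deriv (by
      linear_combination (B * c1 * Complex.exp (B * x) - B * d1 * e * Complex.exp (-B * x)) * eB))
    (fun x => (comb _ _ _ _ x).congr_deriv (by
      linear_combination
        (-A * (c1 * Complex.exp (B * x) + d1 * e * Complex.exp (-B * x))) * eB))
    (by
      simp only [x1, x2, x3, x4]
      have : -(B * c1) * e + -(A * c2) * a + B * d1 * 1 + A * d2 * 1 = 0 := by
        rw [hc1, hc2, hd1, hd2, hk1, hk2, hM]; field_simp; ring
      linear_combination this + B * d1 * heb + A * d2 * hab)
    (by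
      simp only [x1, x2, x3, x4]
      have : A * c1 * e + A * c2 * a + A * d1 * 1 + A * d2 * 1 = 0 := by
        rw [hc1, hc2, hd1, hd2, hk1, hk2, hM]; field_simp; ring
      linear_combination this + A * d1 * heb + A * d2 * hab)
  simp only [Complex.ofReal_zero, mul_zero, Complex.exp_zero, mul_one] at key
  have r1 : -(B * c1) + -(A * c2) + B * d1 * e + A * d2 * a = g1 := by
    rw [hg1, hM, hc1, hc2, hd1, hd2]; field_simp; ring
  have r2 : A * c1 + A * c2 + A * d1 * e + A * d2 * a = g2 := by
    rw [hg2, hM, hc1, hc2, hd1, hd2]; field_simp; ring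
  have r3 : -(μ * (A ^ 2 + B ^ 2) * c1) + -(2 * μ * A ^ 2 * c2) + -(μ * (A ^ 2 + B ^ 2) * d1 * e)
      + -(2 * μ * A ^ 2 * d2 * a) = -s1 := by
    rw [hs1, hM, hc1, hc2, hd1, hd2]; field_simp; ring
  have r4 : 2 * μ * A * B * c1 + (2 * μ * A ^ 2 + γ * lam) * c2 + -(2 * μ * A * B * d1 * e)
      + -((2 * μ * A ^ 2 + γ * lam) * d2 * a) = -s2 := by
    rw [hs2, hM, hc1, hc2, hd1, hd2, eB]; field_simp; ring
  rw [r1, r2, r3, r4] at key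
  have r5 : ω * (-s1 * conj g1 + -s2 * conj g2) = -(ω * (s1 * conj g1 + s2 * conj g2)) := by ring
  rw [r5, Complex.neg_re] at key
  exact key

/-- Below unit tangential frequency the flux bound wins, above it the trace bound. -/
theorem exists_flux_weight {b l : ℝ} (hb : 0 < b) (hl : 0 < l) :
    ∃ C : ℝ, 0 < C ∧ ∀ A ρ : ℝ, 0 < A → l ≤ ρ → ∃ m : ℝ, 0 ≤ m ∧
      (m = 1 / A ∨ m = 1 / (Real.exp 1 * b * A ^ 2)) ∧
      C * (ρ + A) ^ 2 ≤ A * ((ρ + A) / 4 + ρ ^ 2 * m) * (1 - Real.exp (-(A * b))) := by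
  have hb1 : Real.exp (-b) < 1 := by rw [Real.exp_lt_one_iff]; linarith
  have hE := Real.exp_pos (-b)
  have hE1 := Real.exp_pos 1
  -- For `A ≥ 1` the factor `1 - e^{-Ab}` is bounded below. For `A ≤ 1` it is at least `A b e^{-b}`,
  -- so the powers of `A` cancel against `1/A²` and leave `ρ²`, comparable to `(ρ + A)²` because `ρ
  -- ≥ l`.
  refine ⟨min ((1 - Real.exp (-b)) / 8) (Real.exp (-b) / Real.exp 1 / (1 + 1 / l) ^ 2),
    lt_min (by linarith) (by positivity), fun A ρ hA hρ => ?_⟩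
  have hρ0 : 0 < ρ := hl.trans_le hρ
  rcases le_total 1 A with h | h
  · refine ⟨1 / A, by positivity, Or.inl rfl, ?_⟩
    have h1 : 1 - Real.exp (-b) ≤ 1 - Real.exp (-(A * b)) := by
      have : Real.exp (-(A * b)) ≤ Real.exp (-b) := Real.exp_le_exp.mpr (by nlinarith)
      linarith
    have h2 : (1 / 8) * (ρ + A) ^ 2 ≤ A * ((ρ + A) / 4 + ρ ^ 2 * (1 / A)) := by
      have : A * ((ρ + A) / 4 + ρ ^ 2 * (1 / A)) = A * (ρ + A) / 4 + ρ ^ 2 := by field_simp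
      rw [this]; nlinarith [sq_nonneg A, sq_nonneg ρ]
    calc _ ≤ (1 - Real.exp (-b)) / 8 * (ρ + A) ^ 2 := by gcongr; exact min_le_left _ _
      _ = (1 / 8) * (ρ + A) ^ 2 * (1 - Real.exp (-b)) := by ring
      _ ≤ _ := by
        have : 0 ≤ 1 - Real.exp (-b) := by linarith
        gcongr
  · refine ⟨1 / (Real.exp 1 * b * A ^ 2), by positivity, Or.inr rfl, ?_⟩
    have h1 : A * b * Real.exp (-b) ≤ 1 - Real.exp (-(A * b)) := by
      have h3 := Real.add_one_le_exp (A * b)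
      have h4 : Real.exp (A * b) * Real.exp (-(A * b)) = 1 := by
        rw [← Real.exp_add, add_neg_cancel, Real.exp_zero]
      have h5 : Real.exp (-b) ≤ Real.exp (-(A * b)) := Real.exp_le_exp.mpr (by nlinarith)
      have h6 := Real.exp_pos (-(A * b))
      have h7 : A * b * Real.exp (-b) ≤ A * b * Real.exp (-(A * b)) := by gcongr
      nlinarith
    have h2 : ρ + A ≤ ρ * (1 + 1 / l) := by
      have : 1 ≤ ρ * (1 / l) := by rw [mul_one_div, le_div_iff₀ hl]; linarith
      linarith
    calc _ ≤ Real.exp (-b) / Real.exp 1 / (1 + 1 / l) ^ 2 * (ρ * (1 + 1 / l)) ^ 2 := by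
          gcongr; exact min_le_right _ _
      _ = A * (ρ ^ 2 * (1 / (Real.exp 1 * b * A ^ 2))) * (A * b * Real.exp (-b)) := by
          field_simp
      _ ≤ _ := by
          gcongr
          have : 0 ≤ (ρ + A) / 4 := by positivity
          linarith

/-! ### Coercivity of the interface matrix -/

namespace PhysParams

variable (P : PhysParams) (lam delta : ℂ) (A : ℝ)

theorem rootAP_sq : P.rootAP lam delta A ^ 2
    = (P.gam1P : ℂ) * ((P.muP : ℂ) + (P.nuP : ℂ) + delta)⁻¹ * lam + (A : ℂ) ^ 2 := csqrt_sq _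

theorem rootBP_sq : P.rootBP lam A ^ 2
    = (P.gam1P : ℂ) * (P.muP : ℂ)⁻¹ * lam + (A : ℂ) ^ 2 := csqrt_sq _

theorem rootBM_sq : P.rootBM lam A ^ 2
    = (P.gam1M : ℂ) * (P.muM : ℂ)⁻¹ * lam + (A : ℂ) ^ 2 := csqrt_sq _

theorem kerM_neg_b : P.kerM lam A (-P.b) = (P.expB lam A - P.expA A) / (P.rootBM lam A - A) := by
  unfold kerM expB expA
  rw [Complex.ofReal_neg, mul_neg, mul_neg]

/-- The matrix of the trace of the layer solution on the interface in terms of its parameters. -/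
def traceMat : Matrix (Fin 2) (Fin 2) ℂ :=
  !![P.colFactor1 lam A - A * ((A + P.rootBM lam A) * P.kerM lam A (-P.b) ^ 2),
     -(A * (P.rootBM lam A * ((A + P.rootBM lam A) * P.kerM lam A (-P.b) ^ 2)));
     -(A * ((A + P.rootBM lam A) * P.kerM lam A (-P.b) ^ 2)),
     A * (P.colFactor2 lam A
      - P.rootBM lam A * ((A + P.rootBM lam A) * P.kerM lam A (-P.b) ^ 2))]

/-- The factor `A` comes from the second row: the second parameter is normal velocity divided by
`A`. -/
theorem det_traceMat (hBA : P.rootBM lam A ≠ A) : (P.traceMat lam A).det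
    = A * ((1 - P.expB lam A * P.expA A) ^ 2 - (A + P.rootBM lam A) ^ 2
      * ((P.expB lam A - P.expA A) / (P.rootBM lam A - A)) ^ 2) := by
  have hBA' : P.rootBM lam A - A ≠ 0 := sub_ne_zero.mpr hBA
  rw [Matrix.det_fin_two]
  simp only [traceMat, colFactor1, colFactor2, kerM_neg_b, Matrix.of_apply, Matrix.cons_val',
    Matrix.cons_val_zero, Matrix.cons_val_one, Matrix.cons_val_fin_one]
  field_simp
  ring

section Coercive

variable {P lam delta A} {c0 : ℝ} {ω : ℂ}

/-- An open half-plane is stable under such combinations. This one fact puts the roots `A₊`, `B₊` in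
the open right half-plane and keeps `A₊B₊ - A²` from vanishing. -/
theorem energy_coeff_ne_zero (hP : P.Positive) (hc0 : 0 < c0) (hω : ω.re = 1) (hlam0 : lam ≠ 0)
    (hlam : c0 * ‖lam‖ ≤ (ω * lam).re) (hκ : c0 ≤ (ω * (P.nuP + delta)).re)
    {x y : ℝ} (hx : 0 ≤ x) (hy : 0 ≤ y) :
    (P.gam1P : ℂ) * lam + x + y * (P.nuP + delta) ≠ 0 := by
  intro h
  have h1 : (ω * ((P.gam1P : ℂ) * lam + x + y * (P.nuP + delta))).re
      = P.gam1P * (ω * lam).re + x + y * (ω * (P.nuP + delta)).re := by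
    have : ω * ((P.gam1P : ℂ) * lam + x + y * (P.nuP + delta))
        = P.gam1P * (ω * lam) + ω * x + y * (ω * (P.nuP + delta)) := by ring
    rw [this, Complex.add_re, Complex.add_re, Complex.re_ofReal_mul, Complex.re_mul_ofReal,
      Complex.re_ofReal_mul, hω, one_mul]
  rw [h, mul_zero, Complex.zero_re] at h1
  have h2 : 0 < (ω * lam).re := lt_of_lt_of_le (mul_pos hc0 (norm_pos_iff.mpr hlam0)) hlam
  have h3 := mul_pos hP.gam1P_pos h2
  have h4 : 0 ≤ y * (ω * (P.nuP + delta)).re := mul_nonneg hy (hc0.le.trans hκ)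
  linarith

/-- The matrix `𝐋` is coercive relative to the trace matrix of the layer. -/
theorem matL_coercive (hP : P.Positive) (hc0 : 0 < c0) (hω : ω.re = 1) (hlam0 : lam ≠ 0)
    (hlam : c0 * ‖lam‖ ≤ (ω * lam).re) (hκ : c0 ≤ (ω * (P.nuP + delta)).re) (hA : 0 < A)
    (hBA : P.rootBM lam A ≠ A) {c m : ℝ} (hc : 0 < c) (hcμ : c ≤ P.muP) (hcc : c ≤ c0)
    (hcP : c ≤ P.gam1P * c0) (hcM : c ≤ P.gam1M * c0)
    (hm : m = 1 / A ∨ m = 1 / (Real.exp 1 * P.b * A ^ 2)) (x y : ℂ) :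
    c / 4 * (√‖lam‖ + A) * ‖P.traceMat lam A 0 0 * x + P.traceMat lam A 0 1 * y‖ ^ 2
      + (c / 4 * (√‖lam‖ + A) + c * ‖lam‖ * m)
        * ‖P.traceMat lam A 1 0 * x + P.traceMat lam A 1 1 * y‖ ^ 2 ≤
    (-ω * ((P.matL lam delta A 0 0 * x + P.matL lam delta A 0 1 * y)
        * conj (P.traceMat lam A 0 0 * x + P.traceMat lam A 0 1 * y)
      + (P.matL lam delta A 1 0 * x + P.matL lam delta A 1 1 * y)
        * conj (P.traceMat lam A 1 0 * x + P.traceMat lam A 1 1 * y))).re := by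
  have hne := @energy_coeff_ne_zero P lam delta c0 ω hP hc0 hω hlam0 hlam hκ
  have hμ := hP.muP_pos
  have hμ' : (P.muP : ℂ) ≠ 0 := Complex.ofReal_ne_zero.mpr hμ.ne'
  have hμM : (P.muM : ℂ) ≠ 0 := Complex.ofReal_ne_zero.mpr hP.muM_pos.ne'
  have hγ' : (P.gam1P : ℂ) ≠ 0 := Complex.ofReal_ne_zero.mpr hP.gam1P_pos.ne'
  have hμκ : (P.muP : ℂ) + P.nuP + delta ≠ 0 := by
    intro h
    have h1 : (ω * (P.muP + P.nuP + delta)).re = P.muP + (ω * (P.nuP + delta)).re := by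
      rw [add_assoc, mul_add, Complex.add_re, Complex.re_mul_ofReal, hω, one_mul]
    rw [h, mul_zero, Complex.zero_re] at h1
    linarith
  set α := P.rootAP lam delta A with hα
  set β := P.rootBP lam A with hβ
  set B := P.rootBM lam A with hB
  set e := P.expB lam A with he
  set a := P.expA A with ha
  set M := P.kerM lam A (-P.b) with hM
  set D := P.den lam delta A with hD
  have eα : (P.gam1P : ℂ) * lam = (P.muP + (P.nuP + delta)) * (α ^ 2 - (A : ℂ) ^ 2) := by
    rw [hα, rootAP_sq, ← add_assoc]; field_simp; ring
  have eβ : (P.gam1P : ℂ) * lam = P.muP * (β ^ 2 - (A : ℂ) ^ 2) := by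
    rw [hβ, rootBP_sq]; field_simp; ring
  have eB : (P.gam1M : ℂ) * lam = P.muM * (B ^ 2 - (A : ℂ) ^ 2) := by
    rw [hB, rootBM_sq]; field_simp; ring
  have hαre : 0 < α.re := by
    refine re_pos_of_sq_ne (csqrt_re_nonneg _) fun s hs h => ?_
    refine hne (x := (s + A ^ 2) * P.muP) (y := s + A ^ 2) (by positivity) (by positivity) ?_
    rw [eα, h]; push_cast; ring
  have hβre : 0 < β.re := by
    refine re_pos_of_sq_ne (csqrt_re_nonneg _) fun s hs h => ?_
    refine hne (x := (s + A ^ 2) * P.muP) (y := 0) (by positivity) le_rfl ?_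
    rw [eβ, h]; push_cast; ring
  have hD0 : D ≠ 0 := by
    intro h
    have h1 : α * β = (A : ℂ) ^ 2 := sub_eq_zero.mp h
    have h2 : (P.gam1P : ℂ) * lam
        * ((P.gam1P : ℂ) * lam + (A ^ 2 * (2 * P.muP) : ℝ) + (A ^ 2 : ℝ) * (P.nuP + delta)) = 0 := by
      push_cast
      -- Squaring `αβ = A²` and clearing viscosities gives `γλ (γλ + A²(2μ + κ)) = 0` with `κ = ν₊ +
      -- δ`, where neither factor can vanish.
      have e1 : (α ^ 2 - (A : ℂ) ^ 2) * (β ^ 2 - (A : ℂ) ^ 2)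
          + (A : ℂ) ^ 2 * ((α ^ 2 - (A : ℂ) ^ 2) + (β ^ 2 - (A : ℂ) ^ 2)) = 0 := by
        linear_combination (α * β + (A : ℂ) ^ 2) * h1
      linear_combination P.muP * (P.muP + (P.nuP + delta)) * e1
        + (P.gam1P * lam + (A : ℂ) ^ 2 * P.muP) * eα
        + ((P.muP + (P.nuP + delta)) * (α ^ 2 - (A : ℂ) ^ 2)
          + (A : ℂ) ^ 2 * (P.muP + (P.nuP + delta))) * eβ
    rcases mul_eq_zero.mp h2 with h3 | h3
    · exact mul_ne_zero hγ' hlam0 h3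
    · exact hne (by positivity) (by positivity) h3
  set g1 := P.traceMat lam A 0 0 * x + P.traceMat lam A 0 1 * y with hg1
  set g2 := P.traceMat lam A 1 0 * x + P.traceMat lam A 1 1 * y with hg2
  have hlamn := norm_nonneg lam
  have up := halfLine_coercive (A := A) (μ := P.muP) (γ := P.gam1P) (c := c) (lam := lam)
    (κ := P.nuP + delta) (ω := ω) (α := α) (β := β) (D := D) hA hc hω hcμ
    (by
      calc c * ‖lam‖ ≤ P.gam1P * c0 * ‖lam‖ := by gcongr
        _ = P.gam1P * (c0 * ‖lam‖) := by ring
        _ ≤ _ := mul_le_mul_of_nonneg_left hlam hP.gam1P_pos.le)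
    (hcc.trans hκ) hαre hβre rfl hD0 eα eβ g1 g2
  set k1 := -(x * e + A * (x + B * y) * M) with hk1
  set k2 := -(y * e - (x + B * y) * M) with hk2
  have low := layer_coercive (A := A) (μ := P.muM) (γ := P.gam1M) (c := c) (b := P.b) (lam := lam)
    (ω := ω) (B := B) (e := e) (a := a) (M := M) (h1 := x) (h2 := y) (k1 := k1) (k2 := k2)
    (g1 := g1) (g2 := g2) hA hP.b_pos hc hω hP.muM_pos.le
    (by
      calc c * ‖lam‖ ≤ P.gam1M * c0 * ‖lam‖ := by gcongr
        _ = P.gam1M * (c0 * ‖lam‖) := by ring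
        _ ≤ _ := mul_le_mul_of_nonneg_left hlam hP.gam1M_pos.le)
    hBA eB rfl rfl (P.kerM_neg_b lam A) hk1 hk2
    (by
      rw [hg1, hk1, hk2]
      simp only [traceMat, colFactor1, colFactor2, Matrix.of_apply, Matrix.cons_val',
        Matrix.cons_val_zero, Matrix.cons_val_one, Matrix.cons_val_fin_one]
      rw [← hB, ← hM, ← he]
      ring)
    (by
      rw [hg2, hk1, hk2]
      simp only [traceMat, colFactor1, colFactor2, Matrix.of_apply, Matrix.cons_val',
        Matrix.cons_val_zero, Matrix.cons_val_one, Matrix.cons_val_fin_one]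
      rw [← hB, ← hM, ← he]
      ring) rfl rfl
  set s1 := -(P.muM : ℂ) * (A + B) * x + -P.muM * (B - A) * A * y
      + (P.muM * ((A + B) * e + 2 * A ^ 2 * M)) * k1
      + (-P.muM * (2 * A ^ 2 * B * M + (B - A) * A * e)) * k2 with hs1
  set s2 := -(P.muM : ℂ) * (B - A) * x + -P.muM * (A + B) * B * y
      + (2 * P.muM * A * B * M - P.muM * (B - A) * a) * k1
      + (-2 * P.muM * A ^ 2 * B * M + P.muM * (B + A) * B * a) * k2 with hs2
  -- The terms of `𝐋` carrying the `L⁺` coefficients assemble into the half-line matrix applied to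
  -- the trace `g`; all the others form `s`.
  have row1 : P.matL lam delta A 0 0 * x + P.matL lam delta A 0 1 * y
      = (-P.muP * (α * (β ^ 2 - A ^ 2) / D) * g1
            + -P.muP * (A * (2 * α * β - A ^ 2 - β ^ 2) / D) * g2) + s1 := by
    rw [hs1, hg1, hg2, hk1, hk2]
    simp only [matL, frakL1, L11P, L12P, L11Z, L12Z, L11B, L12B, traceMat, colFactor1, colFactor2,
      Matrix.of_apply, Matrix.cons_val', Matrix.cons_val_zero, Matrix.cons_val_one,
      Matrix.cons_val_fin_one]
    simp only [← hB, ← hM, ← he, ← hα, ← hβ, ← hD]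
    ring
  have row2 : P.matL lam delta A 1 0 * x + P.matL lam delta A 1 1 * y
      = (-A * (2 * P.muP * (α * (β - α) / D)
              - ((P.nuP + delta) - P.muP) * ((α ^ 2 - A ^ 2) / D)) * g1
            + -(P.muP + (P.nuP + delta)) * (β * (α ^ 2 - A ^ 2) / D) * g2) + s2 := by
    rw [hs2, hg1, hg2, hk1, hk2]
    simp only [matL, frakL2, L21P, L22P, L21Z, L22Z, L21B, L22B, traceMat, colFactor1, colFactor2,
      Matrix.of_apply, Matrix.cons_val', Matrix.cons_val_zero, Matrix.cons_val_one,
      Matrix.cons_val_fin_one]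
    simp only [← hB, ← hM, ← he, ← hα, ← hβ, ← hD, ← ha]
    ring
  rw [row1, row2]
  have low' : c * ‖lam‖ * m * ‖g2‖ ^ 2 ≤ -(ω * (s1 * conj g1 + s2 * conj g2)).re := by
    have hb := hP.b_pos
    rcases hm with hm | hm
    · rw [hm]
      calc c * ‖lam‖ * (1 / A) * ‖g2‖ ^ 2 = (c * ‖lam‖ * ‖g2‖ ^ 2) / A := by ring
        _ ≤ _ := by rw [div_le_iff₀ hA]; exact low.1.trans_eq (mul_comm _ _)
    · rw [hm]
      calc c * ‖lam‖ * (1 / (Real.exp 1 * P.b * A ^ 2)) * ‖g2‖ ^ 2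
          = (c * ‖lam‖ * ‖g2‖ ^ 2) / (Real.exp 1 * P.b * A ^ 2) := by ring
        _ ≤ _ := by rw [div_le_iff₀ (by positivity)]; exact low.2.trans_eq (mul_comm _ _)
  have split : ∀ S1 S2 : ℂ, (-ω * ((S1 + s1) * conj g1 + (S2 + s2) * conj g2)).re
      = -(ω * (S1 * conj g1 + S2 * conj g2)).re + -(ω * (s1 * conj g1 + s2 * conj g2)).re := by
    intro S1 S2
    rw [← Complex.neg_re, ← Complex.neg_re, ← Complex.add_re]
    congr 1
    ring
  rw [split]
  linarith

end Coercive

end PhysParams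

end

/-! ### The determinant bound -/

theorem lemma3p1 (P : PhysParams) (hP : P.Positive) (ε lam0 delta0 : ℝ)
    (hε : 0 < ε) (hε' : ε < Real.pi / 2) (hlam0 : 0 < lam0) (hdelta0 : 0 < delta0) :
    ∃ C : ℝ, 0 < C ∧
      ∀ lam delta : ℂ, P.MemGamma ε lam0 delta0 lam delta →
        ∀ N : ℕ, 2 ≤ N → ∀ ξ : EuclideanSpace ℝ (Fin (N - 1)), ξ ≠ 0 →
          C * (‖lam‖ ^ (1 / 2 : ℝ) + ‖ξ‖) ^ 3 ≤ ‖(P.matL lam delta ‖ξ‖).det‖ := by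
  obtain ⟨c0, K, hc0, hK, hrot⟩ := exists_rotation P hP hε hε' hlam0 hdelta0
  have hb := hP.b_pos
  have hγP := hP.gam1P_pos
  have hγM := hP.gam1M_pos
  have hμP := hP.muP_pos
  have hμM := hP.muM_pos
  obtain ⟨C1, hC1, hweight⟩ := exists_flux_weight hb (Real.sqrt_pos.mpr hlam0)
  set c := min P.muP (min c0 (min (P.gam1P * c0) (P.gam1M * c0))) with hc
  have hcpos : 0 < c := by positivity
  set η := P.gam1M * P.muM⁻¹ with hη
  have hη0 : 0 < η := by positivity
  -- Lower bound for `Re B₋`, uniform in `A`: `c₀ η λ₀ ≤ Re (ω B₋²) ≤ K² (Re B₋)²`.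
  set s0 := √(c0 * (η * lam0)) / K with hs0
  have hs0pos : 0 < s0 := by positivity
  set Θ := (1 - Real.exp (-(s0 * P.b))) ^ 2
    * (c0 * ((Real.sinh (s0 * (P.b / 2)) / Real.cosh (s0 * (P.b / 2))) ^ 3 / 3)) ^ 2 with hΘ
  have hΘ0 : 0 < Θ := by
    have h1 : Real.exp (-(s0 * P.b)) < 1 := by
      rw [Real.exp_lt_one_iff]
      have := mul_pos hs0pos hb
      linarith
    have h2 : 0 < Real.sinh (s0 * (P.b / 2)) := Real.sinh_pos_iff.mpr (by positivity)
    have h3 := Real.cosh_pos (s0 * (P.b / 2))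
    have h4 : 0 < 1 - Real.exp (-(s0 * P.b)) := by linarith
    positivity
  -- One factor `K²` is the price of the rotation in the coercivity argument, the other in the trace
  -- determinant.
  refine ⟨c ^ 2 / 4 * C1 * Θ / K ^ 4, by positivity, ?_⟩
  intro lam delta hmem N _ ξ hξ
  obtain ⟨hl, ω, hω, hωK, hlam, hκ⟩ := hrot lam delta hmem
  have hA : 0 < ‖ξ‖ := norm_pos_iff.mpr hξ
  set A := ‖ξ‖ with hAdef
  have hn : 0 < ‖lam‖ := hlam0.trans_le hl
  have hlamne : lam ≠ 0 := norm_pos_iff.mp hn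
  rw [← Real.sqrt_eq_rpow]
  set ρ := √‖lam‖ with hρ
  have hρ2 : ρ ^ 2 = ‖lam‖ := Real.sq_sqrt hn.le
  have hρ0 : 0 < ρ := Real.sqrt_pos.mpr hn
  obtain ⟨m, hm0, hm, hw⟩ := hweight A ρ hA (Real.sqrt_le_sqrt hl)
  set B := P.rootBM lam A with hB
  have hB2 : B ^ 2 - (A : ℂ) ^ 2 = (η : ℂ) * lam := by
    rw [hB, P.rootBM_sq, hη]; push_cast; ring
  have hBA : B ≠ A := by
    intro h
    rw [h, sub_self] at hB2
    exact mul_ne_zero (Complex.ofReal_ne_zero.mpr hη0.ne') hlamne hB2.symm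
  have hBc : c0 * ‖B ^ 2 - (A : ℂ) ^ 2‖ ≤ (ω * (B ^ 2 - (A : ℂ) ^ 2)).re := by
    have e1 : ω * ((η : ℂ) * lam) = η * (ω * lam) := by ring
    rw [hB2, norm_mul, Complex.norm_real, Real.norm_of_nonneg hη0.le, e1, Complex.re_ofReal_mul]
    calc c0 * (η * ‖lam‖) = η * (c0 * ‖lam‖) := by ring
      _ ≤ _ := mul_le_mul_of_nonneg_left hlam hη0.le
  have hsB : s0 ≤ B.re := by
    have h1 := re_mul_sq_le (B := B) hω
    have h2 : c0 * (η * lam0) ≤ (ω * B ^ 2).re := by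
      have e1 : ω * B ^ 2 = ω * (B ^ 2 - (A : ℂ) ^ 2) + ω * ((A ^ 2 : ℝ) : ℂ) := by push_cast; ring
      rw [e1, Complex.add_re, Complex.re_mul_ofReal, hω]
      have h3 : c0 * (η * lam0) ≤ c0 * ‖B ^ 2 - (A : ℂ) ^ 2‖ := by
        rw [hB2, norm_mul, Complex.norm_real, Real.norm_of_nonneg hη0.le]
        gcongr
      linarith [sq_nonneg A]
    have h4 : ‖ω‖ ^ 2 * B.re ^ 2 ≤ K ^ 2 * B.re ^ 2 := by gcongr
    rw [hs0, div_le_iff₀ hK]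
    have hBre : 0 ≤ B.re := csqrt_re_nonneg _
    rw [Real.sqrt_le_left (by positivity), mul_pow]
    linarith
  have hdet := norm_trace_det_ge hb hs0pos hsB hA hc0.le hω hωK hBA hBc
  rw [← hΘ] at hdet
  have hTdet : (P.traceMat lam A).det = _ := P.det_traceMat lam A hBA
  rw [PhysParams.expB, PhysParams.expA, ← hB] at hTdet
  set X := (1 - Complex.exp (-(B * P.b)) * Complex.exp (-(A * P.b))) ^ 2 - (A + B) ^ 2
        * ((Complex.exp (-(B * P.b)) - Complex.exp (-(A * P.b))) / (B - A)) ^ 2 with hX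
  have ha1 : Real.exp (-(A * P.b)) < 1 := by
    rw [Real.exp_lt_one_iff]
    have := mul_pos hA hb
    linarith
  have ha1' : 0 < 1 - Real.exp (-(A * P.b)) := by linarith
  have hXpos : 0 < ‖X‖ := by
    have h1 := mul_pos hΘ0 ha1'
    have h2 : 0 < K ^ 2 * ‖X‖ := h1.trans_le hdet
    exact pos_of_mul_pos_right h2 (by positivity)
  have hTne : (P.traceMat lam A).det ≠ 0 := by
    rw [hTdet]
    exact mul_ne_zero (Complex.ofReal_ne_zero.mpr hA.ne') (norm_pos_iff.mp hXpos)
  have hco := PhysParams.matL_coercive (P := P) (delta := delta) hP hc0 hω hlamne hlam hκ hA hBA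
    hcpos (min_le_left _ _) ((min_le_right _ _).trans (min_le_left _ _))
    ((min_le_right _ _).trans ((min_le_right _ _).trans (min_le_left _ _)))
    ((min_le_right _ _).trans ((min_le_right _ _).trans (min_le_right _ _))) hm
  rw [Matrix.det_fin_two] at hTne
  have main := mul_norm_det_le_of_coercive (by positivity) (by positivity) hTne hco
  rw [← Matrix.det_fin_two, ← Matrix.det_fin_two, hTdet, norm_mul, Complex.norm_real,
    Real.norm_of_nonneg hA.le, norm_neg, ← hρ, ← hρ2] at main
  have main' : c / 4 * (ρ + A) * (c / 4 * (ρ + A) + c * ρ ^ 2 * m) * (A * ‖X‖)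
      ≤ K ^ 2 * ‖(P.matL lam delta A).det‖ := main.trans (by gcongr)
  rw [div_mul_eq_mul_div, div_le_iff₀ (by positivity)]
  calc c ^ 2 / 4 * C1 * Θ * (ρ + A) ^ 3
      = c ^ 2 / 4 * (ρ + A) * Θ * (C1 * (ρ + A) ^ 2) := by ring
    _ ≤ c ^ 2 / 4 * (ρ + A) * Θ
        * (A * ((ρ + A) / 4 + ρ ^ 2 * m) * (1 - Real.exp (-(A * P.b)))) := by gcongr
    _ = c ^ 2 / 4 * (ρ + A) * (A * ((ρ + A) / 4 + ρ ^ 2 * m))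
        * (Θ * (1 - Real.exp (-(A * P.b)))) := by ring
    _ ≤ c ^ 2 / 4 * (ρ + A) * (A * ((ρ + A) / 4 + ρ ^ 2 * m)) * (K ^ 2 * ‖X‖) := by gcongr
    _ = K ^ 2 * (c / 4 * (ρ + A) * (c / 4 * (ρ + A) + c * ρ ^ 2 * m) * (A * ‖X‖)) := by ring
    _ ≤ K ^ 2 * (K ^ 2 * ‖(P.matL lam delta A).det‖) := by gcongr
    _ = _ := by ring
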